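/- Let $\omega>0$, $\mu>0$, $2\mu+\lambda>0$, $k_p=\omega/\sqrt{\lambda+2\mu}$, $k_s=\omega/\sqrt{\mu}$. Let $\mathbb{S}$ be the unit circle in $\mathbb{R}^2$; for $\mathbf v=(v_1,v_2)^T$ put $\mathbf v^\perp=(-v_2,v_1)^T$, and put $\hat{\mathbf x}=\mathbf x/|\mathbf x|$. Write $\nabla^\perp=(-\partial_2,\partial_1)^T$, $\operatorname{div}^\perp \mathbf u=\partial_1u_2-\partial_2u_1$, $\Delta^*=\mu\Delta+(\lambda+\mu)\nabla\operatorname{div}$, and $\mathbb{T}_\nu \mathbf u=2\mu\,(\nu\cdot\nabla)\mathbf u+\lambda\,\nu\operatorname{div}\mathbf u-\mu\,\nu^\perp\operatorname{div}^\perp\mathbf u$. Let $\Omega\subset\mathbb{R}^2$ be a nonempty bounded open Lipschitz set with connected exterior $\mathbb{R}^2\setminus\overline\Omega$, let $\mathbf d\in\mathbb{S}$ and $m\in\{p,s\}$, and let $\mathbf u^{in}_p(\mathbf x)=\mathbf d\,e^{ik_p\mathbf x\cdot\mathbf d}$, $\mathbf u^{in}_s(\mathbf x)=\mathbf d^\perp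 e^{ik_s\mathbf x\cdot\mathbf d}$. Let $\mathbf u=\mathbf u^{sc}_{\Omega,m}$ be the field scattered by the rigid body $\Omega$ for the incident field $\mathbf u^{in}_m$: $\Delta^*\mathbf u+\omega^2\mathbf u=0$ in $\mathbb{R}^2\setminus\overline\Omega$; $\mathbf u^{in}_m+\mathbf u$ is of class $H^1_{loc}$ up to $\partial\Omega$ and vanishes on $\partial\Omega$; and, with $\mathbf u_p=-k_p^{-2}\nabla\operatorname{div}\mathbf u$ and $\mathbf u_s=-k_s^{-2}\nabla^\perp\operatorname{div}^\perp\mathbf u$, one has $\partial_r\mathbf u_n-ik_n\mathbf u_n=o(r^{-1/2})$ as $r=|\mathbf x|\to\infty$, uniformly in $\hat{\mathbf x}\in\mathbb{S}$, for $n=p,s$. Its far field patterns $u^\infty_{\Omega,mp},u^\infty_{\Omega,ms}:\mathbb{S}\to\mathbb{C}$ are defined by $$\mathbf u_p(\mathbf x)=\frac{k_p}{\omega}\frac{e^{i\pi/4}}{\sqrt{8\pi\omega}}\frac{e^{ik_p|\mathbf x|}}{\sqrt{|\mathbf x|}}u^\infty_{\Omega,mp}(\hat{\mathbf x})\,\hat{\mathbf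 x}+O(|\mathbf x|^{-3/2}),\qquad \mathbf u_s(\mathbf x)=\frac{k_s}{\omega}\frac{e^{i\pi/4}}{\sqrt{8\pi\omega}}\frac{e^{ik_s|\mathbf x|}}{\sqrt{|\mathbf x|}}u^\infty_{\Omega,ms}(\hat{\mathbf x})\,\hat{\mathbf x}^\perp+O(|\mathbf x|^{-3/2})$$ as $|\mathbf x|\to\infty$, uniformly in $\hat{\mathbf x}\in\mathbb{S}$. Then for every disk $B_r$ of radius $r$ centered at the origin with $\overline\Omega\subset B_r$, the outward energy flux $$J_{mr}:=-4\omega\,\Im\int_{\partial B_r}\mathbf u\cdot\overline{\mathbb{T}_\nu\mathbf u}\,ds,\qquad \nu=\hat{\mathbf x},$$ satisfies $$J_{mr}=\frac1{2\pi}\int_{\mathbb{S}}\left\{k_p|u^\infty_{\Omega,mp}|^2+k_s|u^\infty_{\Omega,ms}|^2\right\}ds .$$ In particular the flux is determined by the phaseless far field data: for fixed $\omega,\lambda,\mu$, if two such scattering problems (with possibly different scatterers, incident directions, wave types and radii) have far field patterns with the same moduli on $\mathbb{S}$, then their outward energy fluxes are equal. -/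

import Mathlib

open Filter Asymptotics MeasureTheory
open scoped Topology NNReal

noncomputable section

namespace Elastic

/-- The physical plane `ℝ²` with its Euclidean norm. -/
abbrev Plane := EuclideanSpace ℝ (Fin 2)

/-- Values of complex displacement fields. -/
abbrev CVec := EuclideanSpace ℂ (Fin 2)

/-! ### Vectors -/

/-- Rotation anticlockwise by `π/2`. -/
def perp (v : Plane) : Plane := !₂[-(v 1), v 0]

/-- A real vector, seen as a complex one. -/
def toC (v : Plane) : CVec := !₂[((v 0 : ℝ) : ℂ), ((v 1 : ℝ) : ℂ)]

/-- The unit vector `x / |x|`. -/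
def unitVec (x : Plane) : Plane := ‖x‖⁻¹ • x

/-- The bilinear (not sesquilinear) product `v · w`. -/
def cdot (v w : CVec) : ℂ := v 0 * w 0 + v 1 * w 1

/-- Componentwise complex conjugation. -/
def conjVec (v : CVec) : CVec :=
  !₂[(starRingEnd ℂ) (v 0), (starRingEnd ℂ) (v 1)]

/-! ### Differential operators -/

/-- The partial derivative in the `i`-th coordinate. -/
def pd (i : Fin 2) (φ : Plane → ℂ) (x : Plane) : ℂ :=
  fderiv ℝ φ x (EuclideanSpace.single i (1 : ℝ))

/-- The gradient `(∂₁, ∂₂)ᵀ`. -/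
def grad (φ : Plane → ℂ) (x : Plane) : CVec := !₂[pd 0 φ x, pd 1 φ x]

/-- The rotated gradient `(-∂₂, ∂₁)ᵀ`. -/
def gradPerp (φ : Plane → ℂ) (x : Plane) : CVec := !₂[-(pd 1 φ x), pd 0 φ x]

/-- The divergence `∂₁u₁ + ∂₂u₂`. -/
def divg (u : Plane → CVec) (x : Plane) : ℂ :=
  pd 0 (fun y => u y 0) x + pd 1 (fun y => u y 1) x

/-- The rotated divergence `-∂₂u₁ + ∂₁u₂`. -/
def divPerp (u : Plane → CVec) (x : Plane) : ℂ :=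
  -(pd 1 (fun y => u y 0) x) + pd 0 (fun y => u y 1) x

/-- The Laplacian of a scalar function. -/
def lap (φ : Plane → ℂ) (x : Plane) : ℂ := pd 0 (pd 0 φ) x + pd 1 (pd 1 φ) x

/-- The componentwise Laplacian of a vector field. -/
def vecLap (u : Plane → CVec) (x : Plane) : CVec :=
  !₂[lap (fun y => u y 0) x, lap (fun y => u y 1) x]

/-- The Lamé operator `Δ* = μ Δ + (λ + μ) grad div`. -/
def lameOp (lam mu : ℝ) (u : Plane → CVec) (x : Plane) : CVec :=
  (mu : ℂ) • vecLap u x + ((lam + mu : ℝ) : ℂ) • grad (divg u) x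

/-- The surface traction `T_ν u = 2μ (ν · grad) u + λ ν div u - μ ν^⊥ div^⊥ u`
at the point `x`, for the normal vector `ν`. -/
def traction (lam mu : ℝ) (ν : Plane) (u : Plane → CVec) (x : Plane) : CVec :=
  ((2 * mu : ℝ) : ℂ) • fderiv ℝ u x ν + ((lam : ℂ) * divg u x) • toC ν
    - ((mu : ℂ) * divPerp u x) • toC (perp ν)

/-! ### Wave numbers, and the compressional and shear parts of a field -/

/-- The compressional wave number `k_p`. -/
def kp (om lam mu : ℝ) : ℝ := om / √(lam + 2 * mu)

/-- The shear wave number `k_s`. -/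
def ks (om mu : ℝ) : ℝ := om / √mu

/-- The compressional part `-k_p⁻² grad div u`. -/
def pPart (om lam mu : ℝ) (u : Plane → CVec) (x : Plane) : CVec :=
  (-(1 / ((kp om lam mu : ℝ) : ℂ) ^ 2)) • grad (divg u) x

/-- The shear part `-k_s⁻² grad^⊥ div^⊥ u`. -/
def sPart (om mu : ℝ) (u : Plane → CVec) (x : Plane) : CVec :=
  (-(1 / ((ks om mu : ℝ) : ℂ) ^ 2)) • gradPerp (divPerp u) x

/-- The radial derivative `∂u/∂r`. -/
def radialDeriv (u : Plane → CVec) (x : Plane) : CVec := fderiv ℝ u x (unitVec x)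

/-- Kupradze's radiation conditions
`∂u_p/∂r - i k_p u_p = o(r^{-1/2})` and `∂u_s/∂r - i k_s u_s = o(r^{-1/2})`,
as `r = |x| → ∞`, uniformly in all directions. -/
def Radiating (om lam mu : ℝ) (u : Plane → CVec) : Prop :=
  ((fun x => radialDeriv (pPart om lam mu u) x
      - (Complex.I * ((kp om lam mu : ℝ) : ℂ)) • pPart om lam mu u x)
    =o[Bornology.cobounded Plane] fun x => ‖x‖ ^ (-(1 / 2) : ℝ)) ∧
  ((fun x => radialDeriv (sPart om mu u) x
      - (Complex.I * ((ks om mu : ℝ) : ℂ)) • sPart om mu u x)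
    =o[Bornology.cobounded Plane] fun x => ‖x‖ ^ (-(1 / 2) : ℝ))

/-! ### The scatterer and the scattered field -/

/-- An open bounded set with Lipschitz boundary (near each boundary point it is, in suitable
Cartesian coordinates, the region above the graph of a Lipschitz function) whose exterior
is connected. -/
structure IsScatterer (Ω : Set Plane) : Prop where
  isOpen : IsOpen Ω
  nonempty : Ω.Nonempty
  isBounded : Bornology.IsBounded Ω
  lipschitz : ∀ x ∈ frontier Ω, ∃ (A : Plane ≃ᵃⁱ[ℝ] Plane) (K : ℝ≥0) (g : ℝ → ℝ),
    LipschitzWith K g ∧ ∀ᶠ y in 𝓝 x, (y ∈ Ω ↔ g (A y 0) < A y 1)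
  exterior_connected : IsConnected (closure Ω)ᶜ

/-- The type of the incident plane wave: compressional or shear. -/
inductive WaveType
  | p
  | s

/-- The incident plane wave of direction `d`: `d e^{i k_p x·d}` (compressional) or
`d^⊥ e^{i k_s x·d}` (shear). -/
def incident (om lam mu : ℝ) (m : WaveType) (d x : Plane) : CVec :=
  match m with
  | .p => Complex.exp (Complex.I * ((kp om lam mu * inner ℝ x d : ℝ) : ℂ)) • toC d
  | .s => Complex.exp (Complex.I * ((ks om mu * inner ℝ x d : ℝ) : ℂ)) • toC (perp d)

/-- For a field `w` that is smooth in the open set `D`: `w` belongs to `H¹₀(D)`, the closure in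
`H¹(D)` of the smooth fields with compact support in `D`. -/
def MemH10 (D : Set Plane) (w : Plane → CVec) : Prop :=
  ∃ φ : ℕ → Plane → CVec,
    (∀ n, ContDiff ℝ (⊤ : ℕ∞) (φ n) ∧ HasCompactSupport (φ n) ∧ tsupport (φ n) ⊆ D) ∧
    Tendsto (fun n => ∫⁻ x in D,
      (‖w x - φ n x‖ₑ ^ 2 + ‖fderiv ℝ w x - fderiv ℝ (φ n) x‖ₑ ^ 2)) atTop (𝓝 0)

/-- For a field `u` that is smooth in the exterior of `Ω`: `u` is of class `H¹` in every bounded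
part of the exterior, up to `∂Ω`, and has trace zero on `∂Ω`. -/
def VanishesOnBoundary (Ω : Set Plane) (u : Plane → CVec) : Prop :=
  ∀ χ : Plane → ℝ, ContDiff ℝ (⊤ : ℕ∞) χ → HasCompactSupport χ →
    MemH10 (closure Ω)ᶜ (fun x => χ x • u x)

/-- `usc` is the field scattered by the rigid body `Ω` when the incident field is the plane wave of
type `m` and direction `d`: a radiating solution of the Navier equation `Δ*u + ω²u = 0` in the
exterior of `Ω` (such solutions are smooth there), for which the total field `u^in + usc` is
locally of class `H¹` up to `∂Ω` and vanishes on `∂Ω`. The values of `usc` on the closure of `Ω` are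
immaterial. -/
structure IsScatteredField (om lam mu : ℝ) (Ω : Set Plane) (m : WaveType) (d : Plane)
    (usc : Plane → CVec) : Prop where
  smooth : ContDiffOn ℝ (⊤ : ℕ∞) usc (closure Ω)ᶜ
  navier : ∀ x ∈ (closure Ω)ᶜ, lameOp lam mu usc x + ((om ^ 2 : ℝ) : ℂ) • usc x = 0
  dirichlet : VanishesOnBoundary Ω (fun x => incident om lam mu m d x + usc x)
  radiating : Radiating om lam mu usc

/-! ### Far field patterns and energy flux -/

/-- The functions `fp` and `fs` on the unit circle (their values elsewhere are immaterial) are the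
compressional and the shear far field pattern of `u`:
`u_p(x) = (k_p/ω) (e^{iπ/4}/√(8πω)) (e^{i k_p |x|}/√|x|) fp(x̂) x̂ + O(|x|^{-3/2})` and
`u_s(x) = (k_s/ω) (e^{iπ/4}/√(8πω)) (e^{i k_s |x|}/√|x|) fs(x̂) x̂^⊥ + O(|x|^{-3/2})`
as `|x| → ∞`, uniformly in all directions. -/
def IsFarField (om lam mu : ℝ) (u : Plane → CVec) (fp fs : Plane → ℂ) : Prop :=
  ((fun x => pPart om lam mu u x
      - (((kp om lam mu / om : ℝ) : ℂ)
          * (Complex.exp (Complex.I * (Real.pi / 4 : ℝ)) / ((√(8 * Real.pi * om) : ℝ) : ℂ))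
          * (Complex.exp (Complex.I * ((kp om lam mu * ‖x‖ : ℝ) : ℂ)) / ((√‖x‖ : ℝ) : ℂ))
          * fp (unitVec x)) • toC (unitVec x))
    =O[Bornology.cobounded Plane] fun x => ‖x‖ ^ (-(3 / 2) : ℝ)) ∧
  ((fun x => sPart om mu u x
      - (((ks om mu / om : ℝ) : ℂ)
          * (Complex.exp (Complex.I * (Real.pi / 4 : ℝ)) / ((√(8 * Real.pi * om) : ℝ) : ℂ))
          * (Complex.exp (Complex.I * ((ks om mu * ‖x‖ : ℝ) : ℂ)) / ((√‖x‖ : ℝ) : ℂ))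
          * fs (unitVec x)) • toC (perp (unitVec x)))
    =O[Bornology.cobounded Plane] fun x => ‖x‖ ^ (-(3 / 2) : ℝ))

/-- The point `r (cos θ, sin θ)`. -/
def circlePt (r θ : ℝ) : Plane := !₂[r * Real.cos θ, r * Real.sin θ]

/-- The integral `∫_{∂B_r} g ds` with respect to arc length over the circle of radius `r` centered
at the origin. -/
def arcIntegral {G : Type*} [NormedAddCommGroup G] [NormedSpace ℝ G] (r : ℝ) (g : Plane → G) : G :=
  ∫ θ in (0 : ℝ)..(2 * Real.pi), r • g (circlePt r θ)

/-- The outward energy flux `-4ω Im ∫_{∂B_r} u · conj (T_ν u) ds` through `∂B_r`, where `ν(x) = x̂`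
is the outward unit normal. -/
def energyFlux (om lam mu : ℝ) (u : Plane → CVec) (r : ℝ) : ℝ :=
  -4 * om * (arcIntegral r fun x =>
    cdot (u x) (conjVec (traction lam mu (unitVec x) u x))).im

end Elastic

end

open Elastic

/-!
Outside the scatterer a solution `u` of the Navier equation splits as
`u = -k_p⁻² grad φ - k_s⁻² grad^⊥ ψ` with the potentials `φ = div u` and `ψ = div^⊥ u`, which solve
the Helmholtz equations with wave numbers `k_p` and `k_s` (`IsNavier.apply_zero`,
`IsNavier.helmholtz_divg` and their analogues).

The flux does not depend on the radius: by Betti's formula the field `Im (u · conj σ)`, where `σ` is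
the stress tensor, is divergence-free (`IsNavier.energyFlux_eq`). So the flux equals its limit as
`r → ∞`, and only the asymptotics of `u` and of its traction are needed. The radiation conditions
give the radial derivatives of `grad φ` and `grad^⊥ ψ`, but the traction also contains `φ` and `ψ`
themselves, about whose size nothing is assumed. Two consequences of the Helmholtz equation
`Δφ + k² φ = 0` on large circles supply what is missing:

* `φ = O(r^{-1/2})`: its oscillation on a circle is controlled by its tangential derivative, which is
  small since the far field of `grad φ` is radial, and its mean by the mean of the radial derivatives
  (`IsRadiatingHelmholtz.isBigO`);
* `∫ ∂φ/∂r conj φ ds` has the same limit as `(i/k) ∫ |∂φ/∂r|² ds`, because `k² φ = -Δφ` and the second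
  tangential derivative, over which there is no pointwise control, can be integrated by parts
  (`IsRadiatingHelmholtz.tendsto_integral`).

With these the flux density becomes, up to terms which integrate to `o(1)`, a combination of
`r |u_p|²` and `r |u_s|²`, the cross terms being of lower order as one part is asymptotically radial
and the other tangential (`IsNavier.tendsto_arcIntegral`). These energy densities converge uniformly
to the squared moduli of the far field patterns, which are therefore continuous
(`far_field_modulus`).
-/

namespace Elastic

/-! ### Calculus of partial derivatives -/

theorem fderiv_apply_eq_pd (f : Plane → ℂ) (x v : Plane) :
    fderiv ℝ f x v = (v 0 : ℂ) * pd 0 f x + (v 1 : ℂ) * pd 1 f x := by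
  have hv : v = v 0 • EuclideanSpace.single (0 : Fin 2) (1 : ℝ)
      + v 1 • EuclideanSpace.single (1 : Fin 2) (1 : ℝ) := by
    ext i
    fin_cases i <;> simp
  conv_lhs => rw [hv]
  simp [pd]

theorem contDiffOn_pd {D : Set Plane} (hD : IsOpen D) {f : Plane → ℂ}
    (hf : ContDiffOn ℝ (⊤ : ℕ∞) f D) (i : Fin 2) : ContDiffOn ℝ (⊤ : ℕ∞) (pd i f) D :=
  (hf.fderiv_of_isOpen hD (m := (⊤ : ℕ∞)) (by norm_cast)).clm_apply contDiffOn_const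

theorem differentiableAt_of_contDiffOn {E : Type*} [NormedAddCommGroup E] [NormedSpace ℝ E]
    {D : Set Plane} (hD : IsOpen D) {f : Plane → E}
    (hf : ContDiffOn ℝ (⊤ : ℕ∞) f D) {x : Plane} (hx : x ∈ D) : DifferentiableAt ℝ f x :=
  (hf.contDiffAt (hD.mem_nhds hx)).differentiableAt (by simp)

theorem pd_comm {D : Set Plane} (hD : IsOpen D) {f : Plane → ℂ}
    (hf : ContDiffOn ℝ (⊤ : ℕ∞) f D) {x : Plane} (hx : x ∈ D) (i j : Fin 2) :
    pd i (pd j f) x = pd j (pd i f) x := by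
  have hc := hf.contDiffAt (hD.mem_nhds hx)
  have hs : IsSymmSndFDerivAt ℝ f x :=
    hc.isSymmSndFDerivAt (by simp only [minSmoothness_of_isRCLikeNormedField]; norm_cast)
  have hd : DifferentiableAt ℝ (fderiv ℝ f) x :=
    differentiableAt_of_contDiffOn hD (hf.fderiv_of_isOpen hD (m := (⊤ : ℕ∞)) (by norm_cast)) hx
  have key : ∀ v w : Plane, fderiv ℝ (fun y => fderiv ℝ f y w) x v
      = fderiv ℝ (fderiv ℝ f) x v w := by
    intro v w
    rw [fderiv_clm_apply hd (differentiableAt_const w)]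
    simp
  unfold pd
  rw [key, key]
  exact hs _ _

section Rules

variable {f g : Plane → ℂ} {x : Plane} (i : Fin 2)

theorem pd_add (hf : DifferentiableAt ℝ f x) (hg : DifferentiableAt ℝ g x) :
    pd i (fun y => f y + g y) x = pd i f x + pd i g x := by
  simp [pd, fderiv_fun_add hf hg]

theorem pd_sub (hf : DifferentiableAt ℝ f x) (hg : DifferentiableAt ℝ g x) :
    pd i (fun y => f y - g y) x = pd i f x - pd i g x := by
  simp [pd, fderiv_fun_sub hf hg]

theorem pd_mul (hf : DifferentiableAt ℝ f x) (hg : DifferentiableAt ℝ g x) :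
    pd i (fun y => f y * g y) x = pd i f x * g x + f x * pd i g x := by
  simp [pd, fderiv_fun_mul hf hg]
  ring

theorem pd_const_mul (c : ℂ) (hf : DifferentiableAt ℝ f x) :
    pd i (fun y => c * f y) x = c * pd i f x := by
  simp [pd, fderiv_const_mul hf]

theorem pd_conj (hf : DifferentiableAt ℝ f x) :
    pd i (fun y => (starRingEnd ℂ) (f y)) x = (starRingEnd ℂ) (pd i f x) := by
  have h := (Complex.conjCLE.toContinuousLinearMap.hasFDerivAt (x := f x)).comp x hf.hasFDerivAt
  have h' : HasFDerivAt (fun y => (starRingEnd ℂ) (f y))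
      (Complex.conjCLE.toContinuousLinearMap.comp (fderiv ℝ f x)) x := h
  simp [pd, h'.fderiv]

theorem pd_congr {D : Set Plane} (hD : IsOpen D) (hx : x ∈ D) (h : ∀ y ∈ D, f y = g y) :
    pd i f x = pd i g x := by
  have : f =ᶠ[𝓝 x] g := by
    filter_upwards [hD.mem_nhds hx] with y hy using h y hy
  simp [pd, this.fderiv_eq]

end Rules

theorem contDiffOn_conj {D : Set Plane} {f : Plane → ℂ} (hf : ContDiffOn ℝ (⊤ : ℕ∞) f D) :
    ContDiffOn ℝ (⊤ : ℕ∞) (fun y => (starRingEnd ℂ) (f y)) D :=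
  Complex.conjCLE.toContinuousLinearMap.contDiff.comp_contDiffOn hf

theorem contDiffOn_apply {D : Set Plane} {u : Plane → CVec} (hu : ContDiffOn ℝ (⊤ : ℕ∞) u D)
    (i : Fin 2) : ContDiffOn ℝ (⊤ : ℕ∞) (fun y => u y i) D :=
  ((EuclideanSpace.proj i : CVec →L[ℂ] ℂ).restrictScalars ℝ).contDiff.comp_contDiffOn hu

theorem differentiableAt_of_apply {u : Plane → CVec} {x : Plane}
    (h : ∀ i, DifferentiableAt ℝ (fun y => u y i) x) : DifferentiableAt ℝ u x := by
  have hu : u = fun y => u y 0 • EuclideanSpace.single (0 : Fin 2) (1 : ℂ)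
      + u y 1 • EuclideanSpace.single (1 : Fin 2) (1 : ℂ) := by
    ext y i
    fin_cases i <;> simp
  rw [hu]
  exact ((h 0).smul_const _).add ((h 1).smul_const _)

theorem fderiv_apply_apply {u : Plane → CVec} {x : Plane} (hu : DifferentiableAt ℝ u x)
    (v : Plane) (i : Fin 2) : fderiv ℝ u x v i = fderiv ℝ (fun y => u y i) x v := by
  have h := (((EuclideanSpace.proj i : CVec →L[ℂ] ℂ).restrictScalars ℝ).hasFDerivAt
    (x := u x)).comp x hu.hasFDerivAt
  have h' : HasFDerivAt (fun y => u y i)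
    (((EuclideanSpace.proj i : CVec →L[ℂ] ℂ).restrictScalars ℝ).comp (fderiv ℝ u x)) x := h
  simp [h'.fderiv]

/-! ### Polar coordinates -/

@[simp] theorem circlePt_zero (r θ : ℝ) : circlePt r θ 0 = r * Real.cos θ := rfl

@[simp] theorem circlePt_one (r θ : ℝ) : circlePt r θ 1 = r * Real.sin θ := rfl

theorem norm_circlePt {r : ℝ} (hr : 0 ≤ r) (θ : ℝ) : ‖circlePt r θ‖ = r := by
  rw [EuclideanSpace.norm_eq, Real.sqrt_eq_iff_mul_self_eq (by positivity) hr]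
  simp only [Fin.sum_univ_two, circlePt_zero, circlePt_one, Real.norm_eq_abs, sq_abs]
  linear_combination r ^ 2 * Real.sin_sq_add_cos_sq θ

theorem unitVec_circlePt {r : ℝ} (hr : 0 < r) (θ : ℝ) :
    unitVec (circlePt r θ) = circlePt 1 θ := by
  ext i
  unfold unitVec
  rw [norm_circlePt hr.le]
  fin_cases i <;> simp [hr.ne']

theorem circlePt_add_two_pi (r θ : ℝ) : circlePt r (θ + 2 * Real.pi) = circlePt r θ := by
  simp [circlePt]

theorem hasDerivAt_circlePt_radius (r θ : ℝ) :
    HasDerivAt (fun ρ => circlePt ρ θ) (circlePt 1 θ) r := by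
  have h : (fun ρ => circlePt ρ θ) = fun ρ => ρ • circlePt 1 θ := by
    ext ρ i
    fin_cases i <;> simp
  rw [h]
  simpa using (hasDerivAt_id r).smul_const (circlePt 1 θ)

theorem hasDerivAt_circlePt_angle (r θ : ℝ) :
    HasDerivAt (fun t => circlePt r t) (r • perp (circlePt 1 θ)) θ := by
  have h : (fun t => circlePt r t) = fun t => (r * Real.cos t) • EuclideanSpace.single 0 (1 : ℝ)
      + (r * Real.sin t) • EuclideanSpace.single 1 (1 : ℝ) := by
    ext t i
    fin_cases i <;> simp
  rw [h]
  have h2 := (((Real.hasDerivAt_cos θ).const_mul r).smul_const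
    (EuclideanSpace.single (0 : Fin 2) (1 : ℝ))).add
      (((Real.hasDerivAt_sin θ).const_mul r).smul_const
        (EuclideanSpace.single (1 : Fin 2) (1 : ℝ)))
  have h3 : r • perp (circlePt 1 θ) = (r * -Real.sin θ) • EuclideanSpace.single (0 : Fin 2) (1 : ℝ)
      + (r * Real.cos θ) • EuclideanSpace.single (1 : Fin 2) (1 : ℝ) := by
    ext i
    fin_cases i <;> simp [perp]
  rw [h3]
  exact h2

theorem contDiff_circlePt : ContDiff ℝ (⊤ : ℕ∞) fun z : ℝ × ℝ => circlePt z.1 z.2 := by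
  rw [contDiff_euclidean]
  intro i
  fin_cases i
  · exact contDiff_fst.mul (Real.contDiff_cos.comp contDiff_snd)
  · exact contDiff_fst.mul (Real.contDiff_sin.comp contDiff_snd)

theorem continuous_circlePt (r : ℝ) : Continuous (circlePt r) :=
  contDiff_circlePt.continuous.comp (by fun_prop : Continuous fun θ : ℝ => (r, θ))

theorem hasDerivAt_comp_radius {f : Plane → ℂ} {r θ : ℝ}
    (hf : DifferentiableAt ℝ f (circlePt r θ)) :
    HasDerivAt (fun ρ => f (circlePt ρ θ))
      ((Real.cos θ : ℂ) * pd 0 f (circlePt r θ) + (Real.sin θ : ℂ) * pd 1 f (circlePt r θ)) r := by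
  have h := hf.hasFDerivAt.comp_hasDerivAt r (hasDerivAt_circlePt_radius r θ)
  rw [fderiv_apply_eq_pd] at h
  simpa [Function.comp_def] using h

theorem hasDerivAt_comp_angle {f : Plane → ℂ} {r θ : ℝ}
    (hf : DifferentiableAt ℝ f (circlePt r θ)) :
    HasDerivAt (fun t => f (circlePt r t))
      ((r : ℂ) * (-(Real.sin θ : ℂ) * pd 0 f (circlePt r θ)
        + (Real.cos θ : ℂ) * pd 1 f (circlePt r θ))) θ := by
  have h := hf.hasFDerivAt.comp_hasDerivAt θ (hasDerivAt_circlePt_angle r θ)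
  rw [fderiv_apply_eq_pd] at h
  refine h.congr_deriv ?_
  simp [perp]
  ring

theorem tendsto_circlePt_cobounded :
    Tendsto (fun z : ℝ × ℝ => circlePt z.1 z.2) (atTop ×ˢ ⊤) (Bornology.cobounded Plane) := by
  rw [← comap_norm_atTop, tendsto_comap_iff]
  refine (tendsto_fst (f := (atTop : Filter ℝ)) (g := (⊤ : Filter ℝ))).congr' ?_
  filter_upwards [tendsto_fst.eventually (eventually_ge_atTop (0 : ℝ))] with z hz
  exact (norm_circlePt hz z.2).symm

/-! ### Fluxes of divergence-free fields through circles -/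

/-- A divergence-free field outside a disk has the same flux through all circles around it: this is
the divergence theorem on a rectangle in polar coordinates. -/
theorem flux_eq_of_div_eq_zero {D : Set Plane} (hD : IsOpen D) {r R : ℝ} (hr : 0 < r)
    (hrR : r ≤ R) (hDr : ∀ x, r ≤ ‖x‖ → x ∈ D) {V W : Plane → ℂ}
    (hV : ContDiffOn ℝ (⊤ : ℕ∞) V D) (hW : ContDiffOn ℝ (⊤ : ℕ∞) W D)
    (hdiv : ∀ x ∈ D, pd 0 V x + pd 1 W x = 0) :
    ∫ θ in (0 : ℝ)..(2 * Real.pi), (r : ℂ) * ((Real.cos θ : ℂ) * V (circlePt r θ)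
        + (Real.sin θ : ℂ) * W (circlePt r θ))
      = ∫ θ in (0 : ℝ)..(2 * Real.pi), (R : ℂ) * ((Real.cos θ : ℂ) * V (circlePt R θ)
        + (Real.sin θ : ℂ) * W (circlePt R θ)) := by
  set cp : ℝ × ℝ → Plane := fun z => circlePt z.1 z.2 with hcp
  set f : ℝ × ℝ → ℂ := fun z => (z.1 : ℂ) * ((Real.cos z.2 : ℂ) * V (cp z)
    + (Real.sin z.2 : ℂ) * W (cp z)) with hf
  set g : ℝ × ℝ → ℂ := fun z => (Real.cos z.2 : ℂ) * W (cp z)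
    - (Real.sin z.2 : ℂ) * V (cp z) with hg
  have hmem : ∀ z : ℝ × ℝ, r ≤ z.1 → cp z ∈ D := fun z hz => hDr _ <| by
    rwa [norm_circlePt (hr.le.trans hz)]
  have hdV : ∀ z : ℝ × ℝ, r ≤ z.1 → DifferentiableAt ℝ V (cp z) := fun z hz =>
    differentiableAt_of_contDiffOn hD hV (hmem z hz)
  have hdW : ∀ z : ℝ × ℝ, r ≤ z.1 → DifferentiableAt ℝ W (cp z) := fun z hz =>
    differentiableAt_of_contDiffOn hD hW (hmem z hz)
  have hdcp : ∀ z, DifferentiableAt ℝ cp z := fun z =>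
    contDiff_circlePt.contDiffAt.differentiableAt (by simp)
  have hcos : ∀ z : ℝ × ℝ, DifferentiableAt ℝ (fun z : ℝ × ℝ => (Real.cos z.2 : ℂ)) z := by
    intro z; fun_prop
  have hsin : ∀ z : ℝ × ℝ, DifferentiableAt ℝ (fun z : ℝ × ℝ => (Real.sin z.2 : ℂ)) z := by
    intro z; fun_prop
  have hfst : ∀ z : ℝ × ℝ, DifferentiableAt ℝ (fun z : ℝ × ℝ => (z.1 : ℂ)) z := by
    intro z; fun_prop
  have hVc : ∀ z : ℝ × ℝ, r ≤ z.1 → DifferentiableAt ℝ (fun z => V (cp z)) z := fun z hz =>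
    (hdV z hz).comp z (hdcp z)
  have hWc : ∀ z : ℝ × ℝ, r ≤ z.1 → DifferentiableAt ℝ (fun z => W (cp z)) z := fun z hz =>
    (hdW z hz).comp z (hdcp z)
  have hdf : ∀ z : ℝ × ℝ, r ≤ z.1 → DifferentiableAt ℝ f z := fun z hz =>
    (hfst z).mul (((hcos z).mul (hVc z hz)).add ((hsin z).mul (hWc z hz)))
  have hdg : ∀ z : ℝ × ℝ, r ≤ z.1 → DifferentiableAt ℝ g z := fun z hz =>
    ((hcos z).mul (hWc z hz)).sub ((hsin z).mul (hVc z hz))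
  -- In polar coordinates the divergence is `r⁻¹ (∂f/∂r + ∂g/∂θ)`.
  have hzero : ∀ z : ℝ × ℝ, r ≤ z.1 → fderiv ℝ f z (1, 0) + fderiv ℝ g z (0, 1) = 0 := by
    rintro ⟨ρ, θ⟩ hz
    have h1 : HasDerivAt (fun t => f (t, θ)) (fderiv ℝ f (ρ, θ) (1, 0)) ρ :=
      HasFDerivAt.comp_hasDerivAt (f := fun t : ℝ => (t, θ)) ρ (hdf (ρ, θ) hz).hasFDerivAt
        ((hasDerivAt_id ρ).prodMk (hasDerivAt_const ρ θ))
    have h2 : HasDerivAt (fun t => g (ρ, t)) (fderiv ℝ g (ρ, θ) (0, 1)) θ :=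
      HasFDerivAt.comp_hasDerivAt (f := fun t : ℝ => (ρ, t)) θ (hdg (ρ, θ) hz).hasFDerivAt
        ((hasDerivAt_const θ ρ).prodMk (hasDerivAt_id θ))
    have h1' : HasDerivAt (fun t => f (t, θ)) _ ρ := (hasDerivAt_id ρ).ofReal_comp.fun_mul
      (((hasDerivAt_comp_radius (hdV (ρ, θ) hz)).const_mul (Real.cos θ : ℂ)).fun_add
        ((hasDerivAt_comp_radius (hdW (ρ, θ) hz)).const_mul (Real.sin θ : ℂ)))
    have h2' : HasDerivAt (fun t => g (ρ, t)) _ θ :=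
      ((Real.hasDerivAt_cos θ).ofReal_comp.fun_mul (hasDerivAt_comp_angle (hdW (ρ, θ) hz))).fun_sub
        ((Real.hasDerivAt_sin θ).ofReal_comp.fun_mul (hasDerivAt_comp_angle (hdV (ρ, θ) hz)))
    rw [h1.unique h1', h2.unique h2']
    have hsc : (Real.sin θ : ℂ) ^ 2 + (Real.cos θ : ℂ) ^ 2 = 1 := by
      exact_mod_cast Real.sin_sq_add_cos_sq θ
    have h0 := hdiv _ (hmem _ hz)
    simp only [hcp, id] at h0 ⊢
    push_cast at hsc ⊢
    linear_combination (ρ : ℂ) * h0 + (ρ : ℂ) * (pd 0 V (circlePt ρ θ) + pd 1 W (circlePt ρ θ)) * hsc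
  have hcf : ContinuousOn f (Set.uIcc r R ×ˢ Set.uIcc 0 (2 * Real.pi)) := by
    rintro z ⟨hz, -⟩
    rw [Set.uIcc_of_le hrR] at hz
    exact (hdf z hz.1).continuousAt.continuousWithinAt
  have hcg : ContinuousOn g (Set.uIcc r R ×ˢ Set.uIcc 0 (2 * Real.pi)) := by
    rintro z ⟨hz, -⟩
    rw [Set.uIcc_of_le hrR] at hz
    exact (hdg z hz.1).continuousAt.continuousWithinAt
  have hbox : ∀ z ∈ Set.uIcc r R ×ˢ Set.uIcc (0 : ℝ) (2 * Real.pi),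
      fderiv ℝ f z (1, 0) + fderiv ℝ g z (0, 1) = 0 := by
    rintro z ⟨hz, -⟩
    rw [Set.uIcc_of_le hrR] at hz
    exact hzero z hz.1
  have hmain := integral2_divergence_prod_of_hasFDerivAt_off_countable f g (fderiv ℝ f) (fderiv ℝ g)
    r 0 R (2 * Real.pi) ∅ Set.countable_empty hcf hcg
    (fun z hz => (hdf z (by
      have := hz.1.1.1
      rw [min_eq_left hrR] at this
      exact this.le)).hasFDerivAt)
    (fun z hz => (hdg z (by
      have := hz.1.1.1
      rw [min_eq_left hrR] at this
      exact this.le)).hasFDerivAt)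
    ((integrableOn_congr_fun hbox (measurableSet_uIcc.prod measurableSet_uIcc)).2
      integrableOn_zero)
  have hleft : ∫ ρ in r..R, ∫ θ in (0 : ℝ)..(2 * Real.pi),
      fderiv ℝ f (ρ, θ) (1, 0) + fderiv ℝ g (ρ, θ) (0, 1) = 0 := by
    rw [intervalIntegral.integral_congr (g := fun _ => (0 : ℂ))]
    · simp
    · intro ρ hρ
      rw [Set.uIcc_of_le hrR] at hρ
      simp [hzero (ρ, _) hρ.1]
  have hper : ∀ ρ, g (ρ, 2 * Real.pi) = g (ρ, 0) := by
    intro ρ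
    have := circlePt_add_two_pi ρ 0
    rw [zero_add] at this
    simp [hg, hcp, this]
  rw [hleft] at hmain
  simp only [hper, sub_self, zero_add] at hmain
  exact (sub_eq_zero.1 hmain.symm).symm

/-! ### Asymptotics at infinity in polar coordinates -/

/-- The filter on polar coordinates `(r, θ)` for `r → ∞`, uniformly in `θ`. -/
def polarInfty : Filter (ℝ × ℝ) := atTop ×ˢ ⊤

theorem eventually_polarInfty {p : ℝ × ℝ → Prop} :
    (∀ᶠ z in polarInfty, p z) ↔ ∀ᶠ r in atTop, ∀ θ, p (r, θ) := by
  rw [polarInfty, prod_top, eventually_comap]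
  refine eventually_congr (Eventually.of_forall fun r => ⟨fun h θ => h _ rfl, ?_⟩)
  rintro h ⟨a, b⟩ rfl
  exact h b

theorem eventually_fst_polarInfty {p : ℝ → Prop} (h : ∀ᶠ r in atTop, p r) :
    ∀ᶠ z in polarInfty, p z.1 :=
  eventually_polarInfty.2 (h.mono fun _ hr _ => hr)

theorem tendsto_fst_polarInfty : Tendsto Prod.fst polarInfty (atTop : Filter ℝ) := tendsto_fst

theorem tendsto_integral_of_isLittleO_one {E : Type*} [NormedAddCommGroup E] [NormedSpace ℝ E]
    {e : ℝ × ℝ → E} (he : e =o[polarInfty] fun _ => (1 : ℝ)) :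
    Tendsto (fun r => ∫ θ in (0 : ℝ)..(2 * Real.pi), e (r, θ)) atTop (𝓝 0) := by
  rw [Metric.tendsto_nhds]
  intro ε hε
  have hpi := Real.pi_pos
  have h := eventually_polarInfty.1 (he.def (c := ε / (4 * Real.pi)) (by positivity))
  filter_upwards [h] with r hr
  rw [dist_zero_right]
  refine (intervalIntegral.norm_integral_le_of_norm_le_const (C := ε / (4 * Real.pi))
    fun θ _ => by simpa using hr θ).trans_lt ?_
  rw [sub_zero, abs_of_pos (by positivity)]
  have : ε / (4 * Real.pi) * (2 * Real.pi) = ε / 2 := by field_simp; norm_num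
  rw [this]
  linarith

/-- The decay rate `r^{-1/2}` of a radiating wave, in polar coordinates. -/
noncomputable def decay (z : ℝ × ℝ) : ℝ := z.1 ^ (-(1 / 2) : ℝ)

theorem decay_sq {z : ℝ × ℝ} (hz : 0 < z.1) : decay z * decay z = z.1⁻¹ := by
  rw [decay, ← Real.rpow_add hz, ← Real.rpow_neg_one]
  norm_num

theorem tendsto_decay : Tendsto decay polarInfty (𝓝 0) :=
  (tendsto_rpow_neg_atTop (by norm_num : (0 : ℝ) < 1 / 2)).comp tendsto_fst_polarInfty

theorem isBigO_decay_mul_isLittleO {f g : ℝ × ℝ → ℂ} (hf : f =O[polarInfty] decay)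
    (hg : g =o[polarInfty] decay) :
    (fun z => (z.1 : ℂ) * (f z * g z)) =o[polarInfty] fun _ => (1 : ℝ) := by
  have h1 : (fun z : ℝ × ℝ => (z.1 : ℂ)) =O[polarInfty] fun z : ℝ × ℝ => z.1 :=
    IsBigO.of_bound 1 (Eventually.of_forall fun z => by simp)
  refine (h1.mul_isLittleO (hf.mul_isLittleO hg)).congr' EventuallyEq.rfl ?_
  filter_upwards [eventually_fst_polarInfty (eventually_gt_atTop 0)] with z hz
  rw [decay_sq hz, mul_inv_cancel₀ hz.ne']

theorem isBigO_decay_mul {f g : ℝ × ℝ → ℂ} (hf : f =O[polarInfty] decay)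
    (hg : g =O[polarInfty] decay) :
    (fun z => f z * g z) =o[polarInfty] fun _ => (1 : ℝ) := by
  refine (hf.mul hg).trans_isLittleO ?_
  rw [isLittleO_one_iff]
  simpa using tendsto_decay.mul tendsto_decay

theorem isBigO_conj {f : ℝ × ℝ → ℂ} {w : ℝ × ℝ → ℝ} {l : Filter (ℝ × ℝ)} (hf : f =O[l] w) :
    (fun z => (starRingEnd ℂ) (f z)) =O[l] w :=
  (IsBigO.of_bound 1 (Eventually.of_forall fun z => by simp) : _ =O[l] f).trans hf

theorem isLittleO_conj {f : ℝ × ℝ → ℂ} {w : ℝ × ℝ → ℝ} {l : Filter (ℝ × ℝ)} (hf : f =o[l] w) :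
    (fun z => (starRingEnd ℂ) (f z)) =o[l] w :=
  (IsBigO.of_bound 1 (Eventually.of_forall fun z => by simp) : _ =O[l] f).trans_isLittleO hf

theorem decay_mul_inv {z : ℝ × ℝ} (hz : 0 < z.1) :
    z.1 ^ (-(3 / 2) : ℝ) = decay z * z.1⁻¹ := by
  rw [decay, ← Real.rpow_neg_one, ← Real.rpow_add hz]
  norm_num

theorem isLittleO_decay_of_isBigO {f : ℝ × ℝ → ℂ}
    (hf : f =O[polarInfty] fun z => z.1 ^ (-(3 / 2) : ℝ)) : f =o[polarInfty] decay := by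
  refine hf.trans_isLittleO ?_
  have h1 : (fun z : ℝ × ℝ => z.1⁻¹) =o[polarInfty] fun _ => (1 : ℝ) := by
    rw [isLittleO_one_iff]
    exact tendsto_inv_atTop_zero.comp tendsto_fst_polarInfty
  refine ((isBigO_refl decay polarInfty).mul_isLittleO h1).congr' ?_ ?_
  · filter_upwards [eventually_fst_polarInfty (eventually_gt_atTop 0)] with z hz
    exact (decay_mul_inv hz).symm
  · exact Eventually.of_forall fun z => mul_one _

/-- If `g(r, θ) = κ(r, θ) f(θ) + O(r^{-3/2})` with `|κ| = K r^{-1/2}`, then `g = O(r^{-1/2})` and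
`|f|` is continuous, because `√r |g|` converges to `K |f|` uniformly. -/
theorem far_field_modulus {g κ : ℝ × ℝ → ℂ} {f : ℝ → ℂ} {K : ℝ} (hK : 0 < K)
    (hf : Function.Periodic f (2 * Real.pi))
    (hg : ∀ᶠ r in atTop, Continuous fun θ => g (r, θ))
    (hκ : ∀ᶠ z in polarInfty, ‖κ z‖ = K * decay z)
    (h : (fun z => g z - κ z * f z.2) =O[polarInfty] fun z => z.1 ^ (-(3 / 2) : ℝ)) :
    Continuous (fun θ => ‖f θ‖) ∧ g =O[polarInfty] decay ∧
      (fun z => z.1 * ‖g z‖ ^ 2 - K ^ 2 * ‖f z.2‖ ^ 2) =o[polarInfty] fun _ => (1 : ℝ) := by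
  obtain ⟨C, hC0, hC⟩ := h.exists_pos
  have hbound : ∀ᶠ z in polarInfty, 0 < z.1 ∧ |√z.1 * ‖g z‖ - K * ‖f z.2‖| ≤ C * z.1⁻¹ := by
    filter_upwards [hC.bound, hκ, eventually_fst_polarInfty (eventually_gt_atTop 0)]
      with z hz hκz hpos
    refine ⟨hpos, ?_⟩
    have hd : √z.1 * decay z = 1 := by
      rw [decay, Real.sqrt_eq_rpow, ← Real.rpow_add hpos]
      norm_num
    have hd0 : 0 < decay z := Real.rpow_pos_of_pos hpos _
    rw [Real.norm_of_nonneg (Real.rpow_nonneg hpos.le _), decay_mul_inv hpos] at hz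
    have h1 := (abs_norm_sub_norm_le (g z) (κ z * f z.2)).trans hz
    rw [norm_mul, hκz] at h1
    have h2 : √z.1 * ‖g z‖ - K * ‖f z.2‖
        = √z.1 * (‖g z‖ - K * decay z * ‖f z.2‖) := by
      linear_combination (K * ‖f z.2‖) * hd
    rw [h2, abs_mul, abs_of_nonneg (Real.sqrt_nonneg _)]
    calc √z.1 * |‖g z‖ - K * decay z * ‖f z.2‖|
        ≤ √z.1 * (C * (decay z * z.1⁻¹)) := by gcongr
      _ = C * z.1⁻¹ := by linear_combination (C * z.1⁻¹) * hd
  have hlim : Tendsto (fun z : ℝ × ℝ => C * z.1⁻¹) polarInfty (𝓝 0) := by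
    simpa using (tendsto_inv_atTop_zero.comp tendsto_fst_polarInfty).const_mul C
  have hunif : TendstoUniformly (fun r θ => √r * ‖g (r, θ)‖) (fun θ => K * ‖f θ‖) atTop := by
    rw [Metric.tendstoUniformly_iff]
    intro ε hε
    have := eventually_polarInfty.1 (hbound.and (hlim.eventually_lt_const hε))
    filter_upwards [this] with r hr θ
    rw [dist_comm, Real.dist_eq]
    exact (hr θ).1.2.trans_lt (hr θ).2
  have hcont : Continuous fun θ => K * ‖f θ‖ := by
    refine hunif.continuous (Eventually.frequently ?_)
    filter_upwards [hg] with r hr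
    exact continuous_const.mul hr.norm
  have hcont' : Continuous fun θ => ‖f θ‖ := by
    refine (continuous_const.mul hcont : Continuous fun θ => K⁻¹ * (K * ‖f θ‖)).congr fun θ => ?_
    exact inv_mul_cancel_left₀ hK.ne' _
  have hper : Function.Periodic (fun θ => K * ‖f θ‖) (2 * Real.pi) := fun θ => by
    simp only [hf θ]
  obtain ⟨M, hM⟩ := (hper.isBounded_of_continuous Real.two_pi_pos.ne' hcont).exists_norm_le
  have hM' : ∀ θ, K * ‖f θ‖ ≤ M := fun θ =>
    (le_abs_self _).trans (hM _ (Set.mem_range_self θ))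
  have hle : ∀ᶠ z in polarInfty, √z.1 * ‖g z‖ ≤ M + 1 := by
    filter_upwards [hbound, hlim.eventually_lt_const one_pos] with z hz h1
    have := (abs_le.1 hz.2).2
    linarith [hM' z.2]
  refine ⟨hcont', ?_, ?_⟩
  · refine IsBigO.of_bound (M + 1) ?_
    filter_upwards [hle, eventually_fst_polarInfty (eventually_gt_atTop 0)] with z hz hpos
    have hd : √z.1 * decay z = 1 := by
      rw [decay, Real.sqrt_eq_rpow, ← Real.rpow_add hpos]
      norm_num
    have hd0 : 0 < decay z := Real.rpow_pos_of_pos hpos _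
    rw [Real.norm_of_nonneg hd0.le]
    calc ‖g z‖ = √z.1 * ‖g z‖ * decay z := by linear_combination (-‖g z‖) * hd
      _ ≤ (M + 1) * decay z := by gcongr
  · rw [isLittleO_one_iff]
    refine squeeze_zero_norm' (a := fun z => C * z.1⁻¹ * (2 * M + 1)) ?_ ?_
    · filter_upwards [hbound, hle] with z hz hl
      have hs : √z.1 ^ 2 = z.1 := Real.sq_sqrt hz.1.le
      have hfac : z.1 * ‖g z‖ ^ 2 - K ^ 2 * ‖f z.2‖ ^ 2
          = (√z.1 * ‖g z‖ - K * ‖f z.2‖) * (√z.1 * ‖g z‖ + K * ‖f z.2‖) := by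
        linear_combination (-‖g z‖ ^ 2) * hs
      rw [hfac, norm_mul, Real.norm_eq_abs, Real.norm_of_nonneg (by positivity)]
      have := hM' z.2
      have hz1 := hz.1
      exact mul_le_mul hz.2 (by linarith) (by positivity) (by positivity)
    · simpa using hlim.mul_const (2 * M + 1)

/-- A periodic function is bounded by its integral over a period and the size of its derivative. -/
theorem norm_le_of_periodic {h h' : ℝ → ℂ} (hh : ∀ θ, HasDerivAt h (h' θ) θ)
    (hper : Function.Periodic h (2 * Real.pi)) {M : ℝ} (hM : ∀ θ, ‖h' θ‖ ≤ M) (θ₀ : ℝ) :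
    ‖h θ₀‖ ≤ ‖∫ θ in (0 : ℝ)..(2 * Real.pi), h θ‖ + 2 * Real.pi * M := by
  have hpi := Real.pi_gt_three
  have hcont : Continuous h := continuous_iff_continuousAt.2 fun θ => (hh θ).continuousAt
  have hM0 : 0 ≤ M := (norm_nonneg _).trans (hM 0)
  have hshift := hper.intervalIntegral_add_eq 0 θ₀
  rw [zero_add] at hshift
  have hdiff : ∀ θ ∈ Set.uIoc θ₀ (θ₀ + 2 * Real.pi), ‖h θ₀ - h θ‖ ≤ M * (2 * Real.pi) := by
    intro θ hθ
    rw [Set.uIoc_of_le (by linarith)] at hθ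
    rw [norm_sub_rev]
    refine (Convex.norm_image_sub_le_of_norm_hasDerivWithin_le (s := Set.univ) (f := h) (f' := h')
      (fun x _ => (hh x).hasDerivWithinAt) (fun x _ => hM x) convex_univ (Set.mem_univ θ₀)
      (Set.mem_univ θ)).trans ?_
    rw [Real.norm_of_nonneg (by linarith [hθ.1])]
    exact mul_le_mul_of_nonneg_left (by linarith [hθ.2]) hM0
  have hint := intervalIntegral.norm_integral_le_of_norm_le_const hdiff
  rw [intervalIntegral.integral_sub (by simp) (hcont.intervalIntegrable _ _),
    intervalIntegral.integral_const, ← hshift, add_sub_cancel_left, abs_of_pos (by linarith)] at hint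
  have h1 : ‖(2 * Real.pi) • h θ₀‖ ≤ ‖∫ θ in (0 : ℝ)..(2 * Real.pi), h θ‖
      + M * (2 * Real.pi) * (2 * Real.pi) := by
    have := norm_add_le ((2 * Real.pi) • h θ₀ - ∫ θ in (0 : ℝ)..(2 * Real.pi), h θ)
      (∫ θ in (0 : ℝ)..(2 * Real.pi), h θ)
    rw [sub_add_cancel] at this
    linarith
  rw [norm_smul, Real.norm_of_nonneg (by linarith)] at h1
  have h2 := norm_nonneg (∫ θ in (0 : ℝ)..(2 * Real.pi), h θ)
  have h3 : 2 * Real.pi * ‖h θ₀‖ ≤ 2 * Real.pi *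
      (‖∫ θ in (0 : ℝ)..(2 * Real.pi), h θ‖ + 2 * Real.pi * M) := by
    nlinarith
  exact le_of_mul_le_mul_left h3 (by linarith)

/-! ### Radiating solutions of the Helmholtz equation -/

/-- The radial derivative `∂φ/∂r` at the point with polar coordinates `z = (r, θ)`. -/
noncomputable def radD (φ : Plane → ℂ) (z : ℝ × ℝ) : ℂ :=
  (Real.cos z.2 : ℂ) * pd 0 φ (circlePt z.1 z.2) + (Real.sin z.2 : ℂ) * pd 1 φ (circlePt z.1 z.2)

/-- The tangential derivative `r⁻¹ ∂φ/∂θ` at the point with polar coordinates `z = (r, θ)`. -/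
noncomputable def tanD (φ : Plane → ℂ) (z : ℝ × ℝ) : ℂ :=
  -(Real.sin z.2 : ℂ) * pd 0 φ (circlePt z.1 z.2) + (Real.cos z.2 : ℂ) * pd 1 φ (circlePt z.1 z.2)

/-- The radial component of the radial derivative of `grad φ`. -/
noncomputable def radRadD (φ : Plane → ℂ) (z : ℝ × ℝ) : ℂ :=
  (Real.cos z.2 : ℂ) * radD (pd 0 φ) z + (Real.sin z.2 : ℂ) * radD (pd 1 φ) z

/-- The tangential component of the radial derivative of `grad φ`. -/
noncomputable def radTanD (φ : Plane → ℂ) (z : ℝ × ℝ) : ℂ :=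
  -(Real.sin z.2 : ℂ) * radD (pd 0 φ) z + (Real.cos z.2 : ℂ) * radD (pd 1 φ) z

theorem cos_sq_add_sin_sq_complex (θ : ℝ) : (Real.cos θ : ℂ) ^ 2 + (Real.sin θ : ℂ) ^ 2 = 1 := by
  exact_mod_cast Real.cos_sq_add_sin_sq θ

section Circle

variable {D : Set Plane} {r : ℝ} {φ : Plane → ℂ}

theorem continuous_comp_circlePt (hD : IsOpen D) (hφ : ContDiffOn ℝ (⊤ : ℕ∞) φ D)
    (hr : ∀ θ, circlePt r θ ∈ D) : Continuous fun θ => φ (circlePt r θ) :=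
  continuous_iff_continuousAt.2 fun θ =>
    ContinuousAt.comp (f := circlePt r) (hφ.contDiffAt (hD.mem_nhds (hr θ))).continuousAt
      (continuous_circlePt r).continuousAt

theorem continuous_radD (hD : IsOpen D) (hφ : ContDiffOn ℝ (⊤ : ℕ∞) φ D)
    (hr : ∀ θ, circlePt r θ ∈ D) : Continuous fun θ => radD φ (r, θ) := by
  have h0 := continuous_comp_circlePt hD (contDiffOn_pd hD hφ 0) hr
  have h1 := continuous_comp_circlePt hD (contDiffOn_pd hD hφ 1) hr
  unfold radD
  fun_prop

theorem continuous_tanD (hD : IsOpen D) (hφ : ContDiffOn ℝ (⊤ : ℕ∞) φ D)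
    (hr : ∀ θ, circlePt r θ ∈ D) : Continuous fun θ => tanD φ (r, θ) := by
  have h0 := continuous_comp_circlePt hD (contDiffOn_pd hD hφ 0) hr
  have h1 := continuous_comp_circlePt hD (contDiffOn_pd hD hφ 1) hr
  unfold tanD
  fun_prop

theorem continuous_radRadD (hD : IsOpen D) (hφ : ContDiffOn ℝ (⊤ : ℕ∞) φ D)
    (hr : ∀ θ, circlePt r θ ∈ D) : Continuous fun θ => radRadD φ (r, θ) := by
  have h0 := continuous_radD hD (contDiffOn_pd hD hφ 0) hr
  have h1 := continuous_radD hD (contDiffOn_pd hD hφ 1) hr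
  unfold radRadD
  fun_prop

theorem continuous_radTanD (hD : IsOpen D) (hφ : ContDiffOn ℝ (⊤ : ℕ∞) φ D)
    (hr : ∀ θ, circlePt r θ ∈ D) : Continuous fun θ => radTanD φ (r, θ) := by
  have h0 := continuous_radD hD (contDiffOn_pd hD hφ 0) hr
  have h1 := continuous_radD hD (contDiffOn_pd hD hφ 1) hr
  unfold radTanD
  fun_prop

theorem hasDerivAt_radD (hD : IsOpen D) (hφ : ContDiffOn ℝ (⊤ : ℕ∞) φ D)
    {θ : ℝ} (hr : circlePt r θ ∈ D) :
    HasDerivAt (fun t => radD φ (r, t)) (r * radTanD φ (r, θ) + tanD φ (r, θ)) θ := by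
  have h0 := differentiableAt_of_contDiffOn hD (contDiffOn_pd hD hφ 0) hr
  have h1 := differentiableAt_of_contDiffOn hD (contDiffOn_pd hD hφ 1) hr
  have h : HasDerivAt (fun t => radD φ (r, t)) _ θ :=
    ((Real.hasDerivAt_cos θ).ofReal_comp.fun_mul (hasDerivAt_comp_angle h0)).fun_add
      ((Real.hasDerivAt_sin θ).ofReal_comp.fun_mul (hasDerivAt_comp_angle h1))
  refine h.congr_deriv ?_
  simp only [radTanD, tanD, radD, pd_comm hD hφ hr 1 0]
  push_cast
  ring

theorem hasDerivAt_tanD (hD : IsOpen D) (hφ : ContDiffOn ℝ (⊤ : ℕ∞) φ D)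
    {θ : ℝ} (hr : circlePt r θ ∈ D) :
    HasDerivAt (fun t => tanD φ (r, t))
      (r * (lap φ (circlePt r θ) - radRadD φ (r, θ)) - radD φ (r, θ)) θ := by
  have h0 := differentiableAt_of_contDiffOn hD (contDiffOn_pd hD hφ 0) hr
  have h1 := differentiableAt_of_contDiffOn hD (contDiffOn_pd hD hφ 1) hr
  have h : HasDerivAt (fun t => tanD φ (r, t)) _ θ :=
    ((Real.hasDerivAt_sin θ).ofReal_comp.neg.fun_mul (hasDerivAt_comp_angle h0)).fun_add
      ((Real.hasDerivAt_cos θ).ofReal_comp.fun_mul (hasDerivAt_comp_angle h1))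
  refine h.congr_deriv ?_
  have hsc := cos_sq_add_sin_sq_complex θ
  simp only [radRadD, radD, lap, pd_comm hD hφ hr 1 0, Pi.neg_apply]
  push_cast at hsc ⊢
  linear_combination (r : ℂ) * (pd 0 (pd 0 φ) (circlePt r θ) + pd 1 (pd 1 φ) (circlePt r θ)) * hsc

theorem periodic_comp_circlePt (φ : Plane → ℂ) (r : ℝ) :
    Function.Periodic (fun θ => φ (circlePt r θ)) (2 * Real.pi) := fun θ => by
  simp only [circlePt_add_two_pi]

theorem periodic_radD (φ : Plane → ℂ) (r : ℝ) :
    Function.Periodic (fun θ => radD φ (r, θ)) (2 * Real.pi) := fun θ => by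
  simp only [radD, circlePt_add_two_pi, Real.cos_add_two_pi, Real.sin_add_two_pi]

theorem periodic_tanD (φ : Plane → ℂ) (r : ℝ) :
    Function.Periodic (fun θ => tanD φ (r, θ)) (2 * Real.pi) := fun θ => by
  simp only [tanD, circlePt_add_two_pi, Real.cos_add_two_pi, Real.sin_add_two_pi]

end Circle

theorem integral_deriv_eq_zero_of_periodic {h h' : ℝ → ℂ} (hh : ∀ θ, HasDerivAt h (h' θ) θ)
    (hc : Continuous h') (hper : Function.Periodic h (2 * Real.pi)) :
    ∫ θ in (0 : ℝ)..(2 * Real.pi), h' θ = 0 := by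
  rw [intervalIntegral.integral_eq_sub_of_hasDerivAt (fun θ _ => hh θ) (hc.intervalIntegrable _ _)]
  have := hper 0
  rw [zero_add] at this
  rw [this, sub_self]

/-- A solution `φ` of the Helmholtz equation `Δφ + k²φ = 0` near infinity whose gradient is
asymptotically radial and satisfies the radiation condition, both components of the latter being
recorded in polar form. Nothing is assumed about the size of `φ` itself. -/
structure IsRadiatingHelmholtz (D : Set Plane) (k : ℝ) (φ : Plane → ℂ) : Prop where
  smooth : ContDiffOn ℝ (⊤ : ℕ∞) φ D
  helmholtz : ∀ x ∈ D, lap φ x + (k : ℂ) ^ 2 * φ x = 0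
  radD_isBigO : radD φ =O[polarInfty] decay
  tanD_isBigO : tanD φ =O[polarInfty] fun z => z.1 ^ (-(3 / 2) : ℝ)
  radRadD_isLittleO : (fun z => radRadD φ z - Complex.I * k * radD φ z) =o[polarInfty] decay
  radTanD_isLittleO : (fun z => radTanD φ z - Complex.I * k * tanD φ z) =o[polarInfty] decay

namespace IsRadiatingHelmholtz

variable {D : Set Plane} {k : ℝ} {φ : Plane → ℂ}

theorem radRadD_isBigO (h : IsRadiatingHelmholtz D k φ) : radRadD φ =O[polarInfty] decay :=
  (h.radRadD_isLittleO.isBigO.add (h.radD_isBigO.const_mul_left (Complex.I * k))).congr_left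
    fun z => by ring

theorem tanD_isLittleO (h : IsRadiatingHelmholtz D k φ) : tanD φ =o[polarInfty] decay :=
  isLittleO_decay_of_isBigO h.tanD_isBigO

theorem radTanD_isLittleO' (h : IsRadiatingHelmholtz D k φ) : radTanD φ =o[polarInfty] decay :=
  (h.radTanD_isLittleO.add (h.tanD_isLittleO.const_mul_left (Complex.I * k))).congr_left
    fun z => by ring

/-- The bound on the tangential derivative controls the oscillation of `φ` on a circle, and the
Helmholtz equation, integrated over the circle, controls its mean value. -/
theorem isBigO (h : IsRadiatingHelmholtz D k φ) (hD : IsOpen D) (hk : 0 < k) {r₀ : ℝ}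
    (hr₀ : ∀ r θ, r₀ ≤ r → circlePt r θ ∈ D) :
    (fun z : ℝ × ℝ => φ (circlePt z.1 z.2)) =O[polarInfty] decay := by
  obtain ⟨A, hA0, hA⟩ := h.radD_isBigO.exists_pos
  obtain ⟨B, hB0, hB⟩ := h.tanD_isBigO.exists_pos
  obtain ⟨H, hH0, hH⟩ := h.radRadD_isBigO.exists_pos
  have hpi := Real.pi_pos
  refine IsBigO.of_bound ((k ^ 2)⁻¹ * ((H + A) * (2 * Real.pi)) + 2 * Real.pi * B) ?_
  rw [eventually_polarInfty]
  filter_upwards [eventually_polarInfty.1 hA.bound, eventually_polarInfty.1 hB.bound,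
    eventually_polarInfty.1 hH.bound, eventually_ge_atTop 1, eventually_ge_atTop r₀]
    with r hAr hBr hHr hr1 hr θ₀
  have hr0 : 0 < r := by linarith
  have hw : 0 < decay (r, θ₀) := Real.rpow_pos_of_pos hr0 _
  set w := decay (r, θ₀) with hwdef
  have hcirc : ∀ θ, circlePt r θ ∈ D := fun θ => hr₀ r θ hr
  have hderiv : ∀ θ, HasDerivAt (fun t => φ (circlePt r t)) (r * tanD φ (r, θ)) θ := fun θ =>
    hasDerivAt_comp_angle (differentiableAt_of_contDiffOn hD h.smooth (hcirc θ))
  have hM : ∀ θ, ‖(r : ℂ) * tanD φ (r, θ)‖ ≤ B * w := by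
    intro θ
    have h1 := hBr θ
    rw [Real.norm_of_nonneg (Real.rpow_nonneg hr0.le _), decay_mul_inv (z := (r, θ)) hr0] at h1
    have h2 : decay (r, θ) = w := rfl
    rw [h2] at h1
    rw [norm_mul, Complex.norm_real, Real.norm_of_nonneg hr0.le]
    calc r * ‖tanD φ (r, θ)‖ ≤ r * (B * (w * r⁻¹)) := by gcongr
      _ = B * w := by field_simp
  have hbound := norm_le_of_periodic hderiv (periodic_comp_circlePt φ r) hM θ₀
  have hzero := integral_deriv_eq_zero_of_periodic
    (fun θ => (hasDerivAt_tanD hD h.smooth (hcirc θ)).const_mul (r⁻¹ : ℂ))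
    (by
      have h1 := continuous_radD hD h.smooth hcirc
      have h2 := continuous_radRadD hD h.smooth hcirc
      have h3 := continuous_comp_circlePt hD
        ((contDiffOn_pd hD (contDiffOn_pd hD h.smooth 0) 0).add
          (contDiffOn_pd hD (contDiffOn_pd hD h.smooth 1) 1)) hcirc
      have h4 : Continuous fun θ => lap φ (circlePt r θ) := h3
      fun_prop)
    (fun θ => by simp only [periodic_tanD φ r θ])
  have hint : ((k : ℂ) ^ 2) * ∫ θ in (0 : ℝ)..(2 * Real.pi), φ (circlePt r θ)
      = -∫ θ in (0 : ℝ)..(2 * Real.pi), (radRadD φ (r, θ) + (r⁻¹ : ℂ) * radD φ (r, θ)) := by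
    have hrc : (r : ℂ) ≠ 0 := by exact_mod_cast hr0.ne'
    rw [← intervalIntegral.integral_neg, ← intervalIntegral.integral_const_mul,
      ← sub_eq_zero, ← intervalIntegral.integral_sub, ← neg_eq_zero,
      ← intervalIntegral.integral_neg, ← hzero]
    · refine intervalIntegral.integral_congr fun θ _ => ?_
      have h0 := h.helmholtz _ (hcirc θ)
      field_simp
      linear_combination (-(r : ℂ)) * h0
    · exact ((continuous_comp_circlePt hD h.smooth hcirc).const_mul _).intervalIntegrable _ _
    · exact (((continuous_radRadD hD h.smooth hcirc).add
        ((continuous_radD hD h.smooth hcirc).const_mul _)).neg).intervalIntegrable _ _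
  have hmean : ‖∫ θ in (0 : ℝ)..(2 * Real.pi), φ (circlePt r θ)‖
      ≤ (k ^ 2)⁻¹ * ((H + A) * w * (2 * Real.pi)) := by
    have h1 : ‖((k : ℂ) ^ 2) * ∫ θ in (0 : ℝ)..(2 * Real.pi), φ (circlePt r θ)‖
        ≤ (H + A) * w * (2 * Real.pi) := by
      rw [hint, norm_neg]
      refine (intervalIntegral.norm_integral_le_of_norm_le_const (C := (H + A) * w)
        fun θ _ => ?_).trans_eq (by rw [sub_zero, abs_of_pos (by positivity)])
      have h2 := hHr θ
      have h3 := hAr θ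
      have h4 : decay (r, θ) = w := rfl
      rw [h4, Real.norm_of_nonneg hw.le] at h2 h3
      refine (norm_add_le _ _).trans ?_
      rw [norm_mul, norm_inv, Complex.norm_real, Real.norm_of_nonneg hr0.le]
      have h5 : r⁻¹ * ‖radD φ (r, θ)‖ ≤ 1 * (A * w) :=
        mul_le_mul (inv_le_one_of_one_le₀ hr1) h3 (norm_nonneg _) zero_le_one
      linarith
    rw [norm_mul, norm_pow, Complex.norm_real, Real.norm_of_nonneg hk.le] at h1
    rwa [inv_mul_eq_div, le_div_iff₀ (by positivity), mul_comm]
  rw [Real.norm_of_nonneg hw.le]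
  refine hbound.trans ?_
  linarith

/-- On large circles `∂φ/∂r · conj φ` has asymptotically the same integral as `(i/k) |∂φ/∂r|²`:
replace `k² φ` by `-Δφ` and integrate the second tangential derivative by parts. -/
theorem tendsto_integral (h : IsRadiatingHelmholtz D k φ) (hD : IsOpen D) {r₀ : ℝ}
    (hr₀ : ∀ r θ, r₀ ≤ r → circlePt r θ ∈ D) :
    Tendsto (fun r : ℝ => ∫ θ in (0 : ℝ)..(2 * Real.pi), (r : ℂ) *
      ((k : ℂ) ^ 2 * (radD φ (r, θ) * (starRingEnd ℂ) (φ (circlePt r θ)))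
        - Complex.I * k * (radD φ (r, θ) * (starRingEnd ℂ) (radD φ (r, θ))))) atTop (𝓝 0) := by
  set e : ℝ × ℝ → ℂ := fun z =>
    -((z.1 : ℂ) * (radD φ z * (starRingEnd ℂ) (radRadD φ z - Complex.I * k * radD φ z)))
      - radD φ z * (starRingEnd ℂ) (radD φ z)
      + (z.1 : ℂ) * (radTanD φ z * (starRingEnd ℂ) (tanD φ z))
      + tanD φ z * (starRingEnd ℂ) (tanD φ z) with he
  have he0 : e =o[polarInfty] fun _ => (1 : ℝ) :=
    (((isBigO_decay_mul_isLittleO h.radD_isBigO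
      (isLittleO_conj h.radRadD_isLittleO)).neg_left.sub
      (isBigO_decay_mul h.radD_isBigO (isBigO_conj h.radD_isBigO))).add
      (isBigO_decay_mul_isLittleO h.radTanD_isLittleO'.isBigO (isLittleO_conj h.tanD_isLittleO))).add
      (isBigO_decay_mul h.tanD_isLittleO.isBigO (isBigO_conj h.tanD_isLittleO.isBigO))
  refine (tendsto_integral_of_isLittleO_one he0).congr' ?_
  filter_upwards [eventually_ge_atTop r₀] with r hr
  have hcirc : ∀ θ, circlePt r θ ∈ D := fun θ => hr₀ r θ hr
  have c0 := continuous_comp_circlePt hD h.smooth hcirc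
  have c1 := continuous_radD hD h.smooth hcirc
  have c2 := continuous_tanD hD h.smooth hcirc
  have c3 := continuous_radRadD hD h.smooth hcirc
  have c4 := continuous_radTanD hD h.smooth hcirc
  have conj_cont : ∀ {f : ℝ → ℂ}, Continuous f → Continuous fun θ => (starRingEnd ℂ) (f θ) :=
    fun hf => Complex.continuous_conj.comp hf
  have c0' := conj_cont c0
  have c1' := conj_cont c1
  have c2' := conj_cont c2
  have c3' := conj_cont c3
  have hlap : ∀ θ, lap φ (circlePt r θ) = -((k : ℂ) ^ 2 * φ (circlePt r θ)) := fun θ =>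
    eq_neg_of_add_eq_zero_left (h.helmholtz _ (hcirc θ))
  have hd : ∀ θ, HasDerivAt (fun t => radD φ (r, t) * (starRingEnd ℂ) (tanD φ (r, t)))
      ((r * radTanD φ (r, θ) + tanD φ (r, θ)) * (starRingEnd ℂ) (tanD φ (r, θ))
        + radD φ (r, θ) * (starRingEnd ℂ)
          (r * (-((k : ℂ) ^ 2 * φ (circlePt r θ)) - radRadD φ (r, θ)) - radD φ (r, θ))) θ := by
    intro θ
    rw [← hlap θ]
    exact (hasDerivAt_radD hD h.smooth (hcirc θ)).fun_mul
      (HasFDerivAt.comp_hasDerivAt θ Complex.conjCLE.toContinuousLinearMap.hasFDerivAt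
        (hasDerivAt_tanD hD h.smooth (hcirc θ)))
  have hzero := integral_deriv_eq_zero_of_periodic hd
    (by
      simp only [map_mul, map_sub, map_neg, map_pow, Complex.conj_ofReal]
      fun_prop)
    (fun θ => by simp only [periodic_tanD φ r θ, periodic_radD φ r θ])
  rw [← add_zero (∫ θ in (0 : ℝ)..(2 * Real.pi), (r : ℂ) * _), ← hzero,
    ← intervalIntegral.integral_add]
  · refine intervalIntegral.integral_congr fun θ _ => ?_
    simp only [he, map_mul, map_sub, map_neg, map_pow, Complex.conj_ofReal, Complex.conj_I]
    ring
  · refine Continuous.intervalIntegrable ?_ _ _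
    fun_prop
  · refine Continuous.intervalIntegrable ?_ _ _
    simp only [map_mul, map_sub, map_neg, map_pow, Complex.conj_ofReal]
    fun_prop

end IsRadiatingHelmholtz

/-! ### The Helmholtz decomposition of a solution of the Navier equation -/

theorem kp_pos {om lam mu : ℝ} (hom : 0 < om) (hlam : 0 < 2 * mu + lam) : 0 < kp om lam mu :=
  div_pos hom (Real.sqrt_pos.2 (by linarith))

theorem ks_pos {om mu : ℝ} (hom : 0 < om) (hmu : 0 < mu) : 0 < ks om mu :=
  div_pos hom (Real.sqrt_pos.2 hmu)

theorem kp_sq {om lam mu : ℝ} (hlam : 0 < 2 * mu + lam) :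
    kp om lam mu ^ 2 * (lam + 2 * mu) = om ^ 2 := by
  have h : 0 < lam + 2 * mu := by linarith
  rw [kp, div_pow, Real.sq_sqrt h.le]
  field_simp

theorem ks_sq {om mu : ℝ} (hmu : 0 < mu) : ks om mu ^ 2 * mu = om ^ 2 := by
  rw [ks, div_pow, Real.sq_sqrt hmu.le]
  field_simp

theorem one_div_kp_sq {om lam mu : ℝ} (hom : 0 < om) (hlam : 0 < 2 * mu + lam) :
    1 / ((kp om lam mu : ℝ) : ℂ) ^ 2 = ((lam : ℂ) + 2 * mu) / (om : ℂ) ^ 2 := by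
  have h := kp_sq (om := om) hlam
  have h' : ((kp om lam mu : ℝ) : ℂ) ^ 2 * ((lam : ℂ) + 2 * mu) = (om : ℂ) ^ 2 := by exact_mod_cast h
  have h1 : ((kp om lam mu : ℝ) : ℂ) ≠ 0 := by exact_mod_cast (kp_pos hom hlam).ne'
  have h2 : (om : ℂ) ≠ 0 := by exact_mod_cast hom.ne'
  field_simp
  linear_combination -h'

theorem one_div_ks_sq {om mu : ℝ} (hom : 0 < om) (hmu : 0 < mu) :
    1 / ((ks om mu : ℝ) : ℂ) ^ 2 = (mu : ℂ) / (om : ℂ) ^ 2 := by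
  have h := ks_sq (om := om) hmu
  have h' : ((ks om mu : ℝ) : ℂ) ^ 2 * (mu : ℂ) = (om : ℂ) ^ 2 := by exact_mod_cast h
  have h1 : ((ks om mu : ℝ) : ℂ) ≠ 0 := by exact_mod_cast (ks_pos hom hmu).ne'
  have h2 : (om : ℂ) ≠ 0 := by exact_mod_cast hom.ne'
  field_simp
  linear_combination -h'

section Decomposition

variable {D : Set Plane} {u : Plane → CVec}

theorem contDiffOn_divg (hD : IsOpen D) (hu : ContDiffOn ℝ (⊤ : ℕ∞) u D) :
    ContDiffOn ℝ (⊤ : ℕ∞) (divg u) D :=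
  (contDiffOn_pd hD (contDiffOn_apply hu 0) 0).add (contDiffOn_pd hD (contDiffOn_apply hu 1) 1)

theorem contDiffOn_divPerp (hD : IsOpen D) (hu : ContDiffOn ℝ (⊤ : ℕ∞) u D) :
    ContDiffOn ℝ (⊤ : ℕ∞) (divPerp u) D :=
  (contDiffOn_pd hD (contDiffOn_apply hu 0) 1).neg.add
    (contDiffOn_pd hD (contDiffOn_apply hu 1) 0)

theorem pd_divg (hD : IsOpen D) (hu : ContDiffOn ℝ (⊤ : ℕ∞) u D) {x : Plane} (hx : x ∈ D)
    (i : Fin 2) : pd i (divg u) x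
      = pd i (pd 0 fun y => u y 0) x + pd i (pd 1 fun y => u y 1) x :=
  pd_add i (differentiableAt_of_contDiffOn hD (contDiffOn_pd hD (contDiffOn_apply hu 0) 0) hx)
    (differentiableAt_of_contDiffOn hD (contDiffOn_pd hD (contDiffOn_apply hu 1) 1) hx)

theorem pd_divPerp (hD : IsOpen D) (hu : ContDiffOn ℝ (⊤ : ℕ∞) u D) {x : Plane} (hx : x ∈ D)
    (i : Fin 2) : pd i (divPerp u) x
      = pd i (pd 0 fun y => u y 1) x - pd i (pd 1 fun y => u y 0) x := by
  have h : divPerp u = fun y => pd 0 (fun y => u y 1) y - pd 1 (fun y => u y 0) y := by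
    funext y
    simp only [divPerp]
    ring
  rw [h]
  exact pd_sub i
    (differentiableAt_of_contDiffOn hD (contDiffOn_pd hD (contDiffOn_apply hu 1) 0) hx)
    (differentiableAt_of_contDiffOn hD (contDiffOn_pd hD (contDiffOn_apply hu 0) 1) hx)

theorem lap_apply_zero (hD : IsOpen D) (hu : ContDiffOn ℝ (⊤ : ℕ∞) u D) {x : Plane} (hx : x ∈ D) :
    lap (fun y => u y 0) x = pd 0 (divg u) x - pd 1 (divPerp u) x := by
  rw [pd_divg hD hu hx, pd_divPerp hD hu hx, pd_comm hD (contDiffOn_apply hu 1) hx 1 0, lap]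
  ring

theorem lap_apply_one (hD : IsOpen D) (hu : ContDiffOn ℝ (⊤ : ℕ∞) u D) {x : Plane} (hx : x ∈ D) :
    lap (fun y => u y 1) x = pd 1 (divg u) x + pd 0 (divPerp u) x := by
  rw [pd_divg hD hu hx, pd_divPerp hD hu hx, pd_comm hD (contDiffOn_apply hu 0) hx 1 0, lap]
  ring

end Decomposition

/-- Smooth solutions of the Navier equation in the set `D`. -/
structure IsNavier (om lam mu : ℝ) (D : Set Plane) (u : Plane → CVec) : Prop where
  smooth : ContDiffOn ℝ (⊤ : ℕ∞) u D
  navier : ∀ x ∈ D, lameOp lam mu u x + ((om ^ 2 : ℝ) : ℂ) • u x = 0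

namespace IsNavier

variable {om lam mu : ℝ} {D : Set Plane} {u : Plane → CVec}

theorem navier_zero (h : IsNavier om lam mu D u) (hD : IsOpen D) {x : Plane} (hx : x ∈ D) :
    ((lam : ℂ) + 2 * mu) * pd 0 (divg u) x - mu * pd 1 (divPerp u) x = -((om : ℂ) ^ 2 * u x 0) := by
  have h0 := congrArg (fun v : CVec => v 0) (h.navier x hx)
  simp only [lameOp, vecLap, grad, PiLp.add_apply, PiLp.smul_apply, smul_eq_mul,
    Matrix.cons_val_zero, PiLp.zero_apply, lap_apply_zero hD h.smooth hx] at h0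
  push_cast at h0
  linear_combination h0

theorem navier_one (h : IsNavier om lam mu D u) (hD : IsOpen D) {x : Plane} (hx : x ∈ D) :
    ((lam : ℂ) + 2 * mu) * pd 1 (divg u) x + mu * pd 0 (divPerp u) x = -((om : ℂ) ^ 2 * u x 1) := by
  have h0 := congrArg (fun v : CVec => v 1) (h.navier x hx)
  simp only [lameOp, vecLap, grad, PiLp.add_apply, PiLp.smul_apply, smul_eq_mul,
    Matrix.cons_val_one, Matrix.cons_val_fin_one, PiLp.zero_apply,
    lap_apply_one hD h.smooth hx] at h0
  push_cast at h0
  linear_combination h0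

theorem apply_zero (h : IsNavier om lam mu D u) (hom : 0 < om) (hmu : 0 < mu)
    (hlam : 0 < 2 * mu + lam) (hD : IsOpen D) {x : Plane} (hx : x ∈ D) :
    u x 0 = -(1 / ((kp om lam mu : ℝ) : ℂ) ^ 2) * pd 0 (divg u) x
      + 1 / ((ks om mu : ℝ) : ℂ) ^ 2 * pd 1 (divPerp u) x := by
  rw [one_div_kp_sq hom hlam, one_div_ks_sq hom hmu]
  have h2 : (om : ℂ) ≠ 0 := by exact_mod_cast hom.ne'
  have h0 := h.navier_zero hD hx
  field_simp
  linear_combination h0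

theorem apply_one (h : IsNavier om lam mu D u) (hom : 0 < om) (hmu : 0 < mu)
    (hlam : 0 < 2 * mu + lam) (hD : IsOpen D) {x : Plane} (hx : x ∈ D) :
    u x 1 = -(1 / ((kp om lam mu : ℝ) : ℂ) ^ 2) * pd 1 (divg u) x
      + -(1 / ((ks om mu : ℝ) : ℂ) ^ 2) * pd 0 (divPerp u) x := by
  rw [one_div_kp_sq hom hlam, one_div_ks_sq hom hmu]
  have h2 : (om : ℂ) ≠ 0 := by exact_mod_cast hom.ne'
  have h0 := h.navier_one hD hx
  field_simp
  linear_combination h0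

theorem pd_apply_zero (h : IsNavier om lam mu D u) (hom : 0 < om) (hmu : 0 < mu)
    (hlam : 0 < 2 * mu + lam) (hD : IsOpen D) {x : Plane} (hx : x ∈ D) (i : Fin 2) :
    pd i (fun y => u y 0) x = -(1 / ((kp om lam mu : ℝ) : ℂ) ^ 2) * pd i (pd 0 (divg u)) x
      + 1 / ((ks om mu : ℝ) : ℂ) ^ 2 * pd i (pd 1 (divPerp u)) x := by
  have d0 := differentiableAt_of_contDiffOn hD (contDiffOn_pd hD (contDiffOn_divg hD h.smooth) 0) hx
  have d1 := differentiableAt_of_contDiffOn hD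
    (contDiffOn_pd hD (contDiffOn_divPerp hD h.smooth) 1) hx
  rw [pd_congr i hD hx fun y hy => h.apply_zero hom hmu hlam hD hy,
    pd_add i (d0.const_mul _) (d1.const_mul _), pd_const_mul i _ d0, pd_const_mul i _ d1]

theorem pd_apply_one (h : IsNavier om lam mu D u) (hom : 0 < om) (hmu : 0 < mu)
    (hlam : 0 < 2 * mu + lam) (hD : IsOpen D) {x : Plane} (hx : x ∈ D) (i : Fin 2) :
    pd i (fun y => u y 1) x = -(1 / ((kp om lam mu : ℝ) : ℂ) ^ 2) * pd i (pd 1 (divg u)) x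
      + -(1 / ((ks om mu : ℝ) : ℂ) ^ 2) * pd i (pd 0 (divPerp u)) x := by
  have d0 := differentiableAt_of_contDiffOn hD (contDiffOn_pd hD (contDiffOn_divg hD h.smooth) 1) hx
  have d1 := differentiableAt_of_contDiffOn hD
    (contDiffOn_pd hD (contDiffOn_divPerp hD h.smooth) 0) hx
  rw [pd_congr i hD hx fun y hy => h.apply_one hom hmu hlam hD hy,
    pd_add i (d0.const_mul _) (d1.const_mul _), pd_const_mul i _ d0, pd_const_mul i _ d1]

theorem helmholtz_divg (h : IsNavier om lam mu D u) (hom : 0 < om) (hmu : 0 < mu)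
    (hlam : 0 < 2 * mu + lam) (hD : IsOpen D) {x : Plane} (hx : x ∈ D) :
    lap (divg u) x + ((kp om lam mu : ℝ) : ℂ) ^ 2 * divg u x = 0 := by
  have h1 : ((kp om lam mu : ℝ) : ℂ) ≠ 0 := by exact_mod_cast (kp_pos hom hlam).ne'
  have h2 : divg u x = -(1 / ((kp om lam mu : ℝ) : ℂ) ^ 2) * lap (divg u) x := by
    rw [divg, h.pd_apply_zero hom hmu hlam hD hx, h.pd_apply_one hom hmu hlam hD hx, lap,
      pd_comm hD (contDiffOn_divPerp hD h.smooth) hx 1 0]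
    ring
  rw [h2]
  field_simp
  ring

theorem helmholtz_divPerp (h : IsNavier om lam mu D u) (hom : 0 < om) (hmu : 0 < mu)
    (hlam : 0 < 2 * mu + lam) (hD : IsOpen D) {x : Plane} (hx : x ∈ D) :
    lap (divPerp u) x + ((ks om mu : ℝ) : ℂ) ^ 2 * divPerp u x = 0 := by
  have h1 : ((ks om mu : ℝ) : ℂ) ≠ 0 := by exact_mod_cast (ks_pos hom hmu).ne'
  have h2 : divPerp u x = -(1 / ((ks om mu : ℝ) : ℂ) ^ 2) * lap (divPerp u) x := by
    rw [divPerp, h.pd_apply_zero hom hmu hlam hD hx, h.pd_apply_one hom hmu hlam hD hx, lap,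
      pd_comm hD (contDiffOn_divg hD h.smooth) hx 1 0]
    ring
  rw [h2]
  field_simp
  ring

end IsNavier

/-! ### Independence of the energy flux of the radius -/

/-- The entry `σᵢⱼ` of the stress tensor, whose `j`-th column is the traction for the `j`-th
basis vector. -/
noncomputable def stress (lam mu : ℝ) (u : Plane → CVec) (i j : Fin 2) (x : Plane) : ℂ :=
  traction lam mu (EuclideanSpace.single j 1) u x i

section Stress

variable {lam mu : ℝ} {D : Set Plane} {u : Plane → CVec} {x : Plane}

theorem traction_apply (hu : DifferentiableAt ℝ u x) (ν : Plane) (i : Fin 2) :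
    traction lam mu ν u x i = 2 * mu * (ν 0 * pd 0 (fun y => u y i) x + ν 1 * pd 1 (fun y => u y i) x)
      + lam * divg u x * ν i - mu * divPerp u x * perp ν i := by
  simp only [traction, PiLp.sub_apply, PiLp.add_apply, PiLp.smul_apply, smul_eq_mul,
    fderiv_apply_apply hu, fderiv_apply_eq_pd]
  fin_cases i <;> simp [toC]

theorem stress_eq (hu : DifferentiableAt ℝ u x) :
    stress lam mu u 0 0 x = 2 * mu * pd 0 (fun y => u y 0) x + lam * divg u x ∧
    stress lam mu u 0 1 x = 2 * mu * pd 1 (fun y => u y 0) x + mu * divPerp u x ∧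
    stress lam mu u 1 0 x = 2 * mu * pd 0 (fun y => u y 1) x - mu * divPerp u x ∧
    stress lam mu u 1 1 x = 2 * mu * pd 1 (fun y => u y 1) x + lam * divg u x := by
  refine ⟨?_, ?_, ?_, ?_⟩ <;> simp [stress, traction_apply hu, perp]

theorem traction_eq_stress (hu : DifferentiableAt ℝ u x) (ν : Plane) (i : Fin 2) :
    traction lam mu ν u x i = ν 0 * stress lam mu u i 0 x + ν 1 * stress lam mu u i 1 x := by
  obtain ⟨h00, h01, h10, h11⟩ := stress_eq (lam := lam) (mu := mu) hu
  rw [traction_apply hu]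
  fin_cases i
  · simp [h00, h01, perp]
    ring
  · simp [h10, h11, perp]
    ring

end Stress

/-- The function `a conj b - conj a b = 2i Im (a conj b)`. -/
noncomputable def skew (a b : Plane → ℂ) (x : Plane) : ℂ :=
  a x * (starRingEnd ℂ) (b x) - (starRingEnd ℂ) (a x) * b x

theorem contDiffOn_skew {D : Set Plane} {a b : Plane → ℂ} (ha : ContDiffOn ℝ (⊤ : ℕ∞) a D)
    (hb : ContDiffOn ℝ (⊤ : ℕ∞) b D) : ContDiffOn ℝ (⊤ : ℕ∞) (skew a b) D :=
  (ha.mul (contDiffOn_conj hb)).sub ((contDiffOn_conj ha).mul hb)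

theorem pd_skew {a b : Plane → ℂ} {x : Plane} (i : Fin 2) (ha : DifferentiableAt ℝ a x)
    (hb : DifferentiableAt ℝ b x) :
    pd i (skew a b) x = pd i a x * (starRingEnd ℂ) (b x) + a x * (starRingEnd ℂ) (pd i b x)
      - (starRingEnd ℂ) (pd i a x) * b x - (starRingEnd ℂ) (a x) * pd i b x := by
  have ha' : DifferentiableAt ℝ (fun y => (starRingEnd ℂ) (a y)) x :=
    Complex.conjCLE.toContinuousLinearMap.differentiableAt.comp x ha
  have hb' : DifferentiableAt ℝ (fun y => (starRingEnd ℂ) (b y)) x :=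
    Complex.conjCLE.toContinuousLinearMap.differentiableAt.comp x hb
  have h : skew a b = fun y => a y * (starRingEnd ℂ) (b y) - (starRingEnd ℂ) (a y) * b y := rfl
  rw [h, pd_sub i (ha.fun_mul hb') (ha'.fun_mul hb), pd_mul i ha hb', pd_mul i ha' hb, pd_conj i ha,
    pd_conj i hb]
  ring

namespace IsNavier

variable {om lam mu : ℝ} {D : Set Plane} {u : Plane → CVec}

theorem contDiffOn_stress (h : IsNavier om lam mu D u) (hD : IsOpen D) (i j : Fin 2) :
    ContDiffOn ℝ (⊤ : ℕ∞) (stress lam mu u i j) D := by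
  have hs : ∀ x ∈ D, DifferentiableAt ℝ u x := fun x hx =>
    differentiableAt_of_contDiffOn hD h.smooth hx
  have hp : ∀ i j : Fin 2, ContDiffOn ℝ (⊤ : ℕ∞) (pd j fun y => u y i) D := fun i j =>
    contDiffOn_pd hD (contDiffOn_apply h.smooth i) j
  have h1 := contDiffOn_divg hD h.smooth
  have h2 := contDiffOn_divPerp hD h.smooth
  have hc : ∀ c : ℂ, ContDiffOn ℝ (⊤ : ℕ∞) (fun _ : Plane => c) D := fun c => contDiffOn_const
  refine ContDiffOn.congr (f := fun x => 2 * (mu : ℂ)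
      * (((EuclideanSpace.single j (1 : ℝ) : Plane) 0 : ℂ) * pd 0 (fun y => u y i) x
        + ((EuclideanSpace.single j (1 : ℝ) : Plane) 1 : ℂ) * pd 1 (fun y => u y i) x)
      + lam * divg u x * ((EuclideanSpace.single j (1 : ℝ) : Plane) i : ℂ)
      - mu * divPerp u x * (perp (EuclideanSpace.single j (1 : ℝ)) i : ℂ)) ?_
      fun x hx => traction_apply (hs x hx) _ i
  exact (((hc _).mul (((hc _).mul (hp i 0)).add ((hc _).mul (hp i 1)))).add
    (((hc _).mul h1).mul (hc _))).sub (((hc _).mul h2).mul (hc _))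

/-- The Navier equation says that the divergence of the stress tensor is `-ω² u`. -/
theorem div_stress (h : IsNavier om lam mu D u) (hD : IsOpen D) {x : Plane} (hx : x ∈ D) :
    pd 0 (stress lam mu u 0 0) x + pd 1 (stress lam mu u 0 1) x = -((om : ℂ) ^ 2 * u x 0) ∧
    pd 0 (stress lam mu u 1 0) x + pd 1 (stress lam mu u 1 1) x = -((om : ℂ) ^ 2 * u x 1) := by
  have hs : ∀ y ∈ D, DifferentiableAt ℝ u y := fun y hy =>
    differentiableAt_of_contDiffOn hD h.smooth hy
  have hp : ∀ i j : Fin 2, DifferentiableAt ℝ (pd j fun y => u y i) x := fun i j =>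
    differentiableAt_of_contDiffOn hD (contDiffOn_pd hD (contDiffOn_apply h.smooth i) j) hx
  have h1 := differentiableAt_of_contDiffOn hD (contDiffOn_divg hD h.smooth) hx
  have h2 := differentiableAt_of_contDiffOn hD (contDiffOn_divPerp hD h.smooth) hx
  rw [pd_congr 0 hD hx fun y hy => (stress_eq (hs y hy)).1,
    pd_congr 1 hD hx fun y hy => (stress_eq (hs y hy)).2.1,
    pd_congr 0 hD hx fun y hy => (stress_eq (hs y hy)).2.2.1,
    pd_congr 1 hD hx fun y hy => (stress_eq (hs y hy)).2.2.2,
    pd_add 0 ((hp 0 0).const_mul _) (h1.const_mul _),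
    pd_add 1 ((hp 0 1).const_mul _) (h2.const_mul _),
    pd_sub 0 ((hp 1 0).const_mul _) (h2.const_mul _),
    pd_add 1 ((hp 1 1).const_mul _) (h1.const_mul _)]
  simp only [pd_const_mul _ _ (hp _ _), pd_const_mul _ _ h1, pd_const_mul _ _ h2]
  have l0 := lap_apply_zero hD h.smooth hx
  have l1 := lap_apply_one hD h.smooth hx
  have n0 := h.navier_zero hD hx
  have n1 := h.navier_one hD hx
  rw [lap] at l0 l1
  exact ⟨by linear_combination 2 * mu * l0 + n0, by linear_combination 2 * mu * l1 + n1⟩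

theorem cdot_traction_eq (h : IsNavier om lam mu D u) (hD : IsOpen D) {r θ : ℝ} (hr : 0 < r)
    (hx : circlePt r θ ∈ D) :
    cdot (u (circlePt r θ))
        (conjVec (traction lam mu (unitVec (circlePt r θ)) u (circlePt r θ)))
      = Real.cos θ * (u (circlePt r θ) 0 * (starRingEnd ℂ) (stress lam mu u 0 0 (circlePt r θ))
          + u (circlePt r θ) 1 * (starRingEnd ℂ) (stress lam mu u 1 0 (circlePt r θ)))
        + Real.sin θ * (u (circlePt r θ) 0 * (starRingEnd ℂ) (stress lam mu u 0 1 (circlePt r θ))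
          + u (circlePt r θ) 1 * (starRingEnd ℂ) (stress lam mu u 1 1 (circlePt r θ))) := by
  have hu := differentiableAt_of_contDiffOn hD h.smooth hx
  rw [unitVec_circlePt hr]
  simp only [cdot, conjVec, Matrix.cons_val_zero, Matrix.cons_val_one, Matrix.cons_val_fin_one,
    traction_eq_stress hu, circlePt_zero, circlePt_one, one_mul, map_add, map_mul,
    Complex.conj_ofReal]
  ring

theorem continuous_cdot_traction (h : IsNavier om lam mu D u) (hD : IsOpen D) {r : ℝ} (hr : 0 < r)
    (hx : ∀ θ, circlePt r θ ∈ D) :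
    Continuous fun θ => cdot (u (circlePt r θ))
      (conjVec (traction lam mu (unitVec (circlePt r θ)) u (circlePt r θ))) := by
  have hs : ∀ i j, Continuous fun θ => (starRingEnd ℂ) (stress lam mu u i j (circlePt r θ)) :=
    fun i j => Complex.continuous_conj.comp
      (continuous_comp_circlePt hD (h.contDiffOn_stress hD i j) hx)
  have hu : ∀ i, Continuous fun θ => u (circlePt r θ) i := fun i =>
    continuous_comp_circlePt hD (contDiffOn_apply h.smooth i) hx
  have hc : Continuous fun θ : ℝ => (Real.cos θ : ℂ) :=
    Complex.continuous_ofReal.comp Real.continuous_cos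
  have hsn : Continuous fun θ : ℝ => (Real.sin θ : ℂ) :=
    Complex.continuous_ofReal.comp Real.continuous_sin
  exact ((hc.mul (((hu 0).mul (hs 0 0)).add ((hu 1).mul (hs 1 0)))).add
    (hsn.mul (((hu 0).mul (hs 0 1)).add ((hu 1).mul (hs 1 1))))).congr
      fun θ => (h.cdot_traction_eq hD hr (hx θ)).symm

/-- Betti's formula: the energy flux field `2i Im (u · conj σ)` is divergence-free, because
`∂ⱼuᵢ conj σᵢⱼ` and `uᵢ conj (∂ⱼσᵢⱼ) = -ω² |u|²` are real. -/
theorem energyFlux_eq (h : IsNavier om lam mu D u) (hD : IsOpen D) {r R : ℝ} (hr : 0 < r)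
    (hrR : r ≤ R) (hDr : ∀ x, r ≤ ‖x‖ → x ∈ D) :
    energyFlux om lam mu u r = energyFlux om lam mu u R := by
  have hcu := fun i => contDiffOn_apply h.smooth i
  have hcs := h.contDiffOn_stress hD
  have hdiv : ∀ x ∈ D,
      pd 0 (fun y => skew (fun y => u y 0) (stress lam mu u 0 0) y
        + skew (fun y => u y 1) (stress lam mu u 1 0) y) x
      + pd 1 (fun y => skew (fun y => u y 0) (stress lam mu u 0 1) y
        + skew (fun y => u y 1) (stress lam mu u 1 1) y) x = 0 := by
    intro x hx
    have hu := fun i => differentiableAt_of_contDiffOn hD (hcu i) hx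
    have hs := fun i j => differentiableAt_of_contDiffOn hD (hcs i j) hx
    have hk := fun i i' j => differentiableAt_of_contDiffOn hD
      (contDiffOn_skew (hcu i) (hcs i' j)) hx
    rw [pd_add 0 (hk 0 0 0) (hk 1 1 0), pd_add 1 (hk 0 0 1) (hk 1 1 1), pd_skew 0 (hu 0) (hs 0 0),
      pd_skew 0 (hu 1) (hs 1 0), pd_skew 1 (hu 0) (hs 0 1), pd_skew 1 (hu 1) (hs 1 1)]
    obtain ⟨e0, e1⟩ := h.div_stress hD hx
    have e0' := congrArg (starRingEnd ℂ) e0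
    have e1' := congrArg (starRingEnd ℂ) e1
    obtain ⟨s00, s01, s10, s11⟩ :=
      stress_eq (lam := lam) (mu := mu) (differentiableAt_of_contDiffOn hD h.smooth hx)
    rw [s00, s01, s10, s11]
    simp only [divg, divPerp, map_add, map_sub, map_neg, map_mul, map_pow, Complex.conj_ofReal,
      map_ofNat] at e0' e1' ⊢
    linear_combination u x 0 * e0' + u x 1 * e1' - (starRingEnd ℂ) (u x 0) * e0
      - (starRingEnd ℂ) (u x 1) * e1
  have hflux := flux_eq_of_div_eq_zero hD hr hrR hDr
    ((contDiffOn_skew (hcu 0) (hcs 0 0)).add (contDiffOn_skew (hcu 1) (hcs 1 0)))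
    ((contDiffOn_skew (hcu 0) (hcs 0 1)).add (contDiffOn_skew (hcu 1) (hcs 1 1))) hdiv
  have key : ∀ ρ, r ≤ ρ → ∫ θ in (0 : ℝ)..(2 * Real.pi), (ρ : ℂ) * ((Real.cos θ : ℂ)
        * (skew (fun y => u y 0) (stress lam mu u 0 0) (circlePt ρ θ)
          + skew (fun y => u y 1) (stress lam mu u 1 0) (circlePt ρ θ))
      + (Real.sin θ : ℂ) * (skew (fun y => u y 0) (stress lam mu u 0 1) (circlePt ρ θ)
        + skew (fun y => u y 1) (stress lam mu u 1 1) (circlePt ρ θ)))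
      = 2 * Complex.I * ((arcIntegral ρ fun x =>
        cdot (u x) (conjVec (traction lam mu (unitVec x) u x))).im : ℂ) := by
    intro ρ hρ
    have hρ0 : 0 < ρ := hr.trans_le hρ
    have hcirc : ∀ θ, circlePt ρ θ ∈ D := fun θ => hDr _ (by rwa [norm_circlePt hρ0.le])
    have hcont : Continuous fun θ => ρ • cdot (u (circlePt ρ θ))
        (conjVec (traction lam mu (unitVec (circlePt ρ θ)) u (circlePt ρ θ))) :=
      (h.continuous_cdot_traction hD hρ0 hcirc).const_smul ρ
    have him := Complex.imCLM.intervalIntegral_comp_comm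
      (hcont.intervalIntegrable (μ := volume) 0 (2 * Real.pi))
    simp only [Complex.imCLM_apply] at him
    rw [arcIntegral, ← him, ← intervalIntegral.integral_ofReal,
      ← intervalIntegral.integral_const_mul]
    refine intervalIntegral.integral_congr fun θ _ => ?_
    have hsub := Complex.sub_conj (ρ • cdot (u (circlePt ρ θ))
      (conjVec (traction lam mu (unitVec (circlePt ρ θ)) u (circlePt ρ θ))))
    have hsub' : 2 * Complex.I * ((ρ • cdot (u (circlePt ρ θ))
        (conjVec (traction lam mu (unitVec (circlePt ρ θ)) u (circlePt ρ θ)))).im : ℂ)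
        = ρ • cdot (u (circlePt ρ θ))
            (conjVec (traction lam mu (unitVec (circlePt ρ θ)) u (circlePt ρ θ)))
          - (starRingEnd ℂ) (ρ • cdot (u (circlePt ρ θ))
            (conjVec (traction lam mu (unitVec (circlePt ρ θ)) u (circlePt ρ θ)))) := by
      rw [hsub]
      push_cast
      ring
    simp only [] at hsub' ⊢
    rw [hsub', h.cdot_traction_eq hD hρ0 (hcirc θ)]
    simp only [skew, Complex.real_smul, map_add, map_mul, Complex.conj_ofReal, Complex.conj_conj]
    ring
  rw [key r le_rfl, key R hrR] at hflux
  have h2i : (2 * Complex.I : ℂ) ≠ 0 := by simp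
  have := Complex.ofReal_injective (mul_left_cancel₀ h2i hflux)
  rw [energyFlux, energyFlux, this]

end IsNavier

/-! ### Radiation conditions and far fields in polar coordinates -/

/-- The radial component of a vector field, in polar coordinates. -/
noncomputable def radComp (F : Plane → CVec) (z : ℝ × ℝ) : ℂ :=
  (Real.cos z.2 : ℂ) * F (circlePt z.1 z.2) 0 + (Real.sin z.2 : ℂ) * F (circlePt z.1 z.2) 1

/-- The tangential component of a vector field, in polar coordinates. -/
noncomputable def tanComp (F : Plane → CVec) (z : ℝ × ℝ) : ℂ :=
  -(Real.sin z.2 : ℂ) * F (circlePt z.1 z.2) 0 + (Real.cos z.2 : ℂ) * F (circlePt z.1 z.2) 1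

theorem norm_combination_le {a b : ℂ} (ha : ‖a‖ ≤ 1) (hb : ‖b‖ ≤ 1) (v : CVec) :
    ‖a * v 0 + b * v 1‖ ≤ 2 * ‖v‖ := by
  have h0 := PiLp.norm_apply_le v 0
  have h1 := PiLp.norm_apply_le v 1
  have h2 := norm_add_le (a * v 0) (b * v 1)
  rw [norm_mul, norm_mul] at h2
  have h3 := mul_le_mul ha h0 (norm_nonneg _) zero_le_one
  have h4 := mul_le_mul hb h1 (norm_nonneg _) zero_le_one
  linarith

theorem norm_cos_le (θ : ℝ) : ‖(Real.cos θ : ℂ)‖ ≤ 1 := by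
  rw [Complex.norm_real]
  exact Real.abs_cos_le_one θ

theorem norm_sin_le (θ : ℝ) : ‖(Real.sin θ : ℂ)‖ ≤ 1 := by
  rw [Complex.norm_real]
  exact Real.abs_sin_le_one θ

theorem radComp_isBigO (F : Plane → CVec) :
    radComp F =O[polarInfty] fun z : ℝ × ℝ => F (circlePt z.1 z.2) :=
  IsBigO.of_bound 2 <| Eventually.of_forall fun _ =>
    norm_combination_le (norm_cos_le _) (norm_sin_le _) _

theorem tanComp_isBigO (F : Plane → CVec) :
    tanComp F =O[polarInfty] fun z : ℝ × ℝ => F (circlePt z.1 z.2) :=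
  IsBigO.of_bound 2 <| Eventually.of_forall fun _ =>
    norm_combination_le (by rw [norm_neg]; exact norm_sin_le _) (norm_cos_le _) _

theorem norm_rpow_circlePt_eventuallyEq (s : ℝ) :
    (fun z : ℝ × ℝ => ‖circlePt z.1 z.2‖ ^ s) =ᶠ[polarInfty] fun z => z.1 ^ s := by
  filter_upwards [eventually_fst_polarInfty (eventually_ge_atTop 0)] with z hz
  rw [norm_circlePt hz]

theorem isBigO_polar {F : Plane → CVec} {s : ℝ}
    (h : F =O[Bornology.cobounded Plane] fun x => ‖x‖ ^ s) :
    (fun z : ℝ × ℝ => F (circlePt z.1 z.2)) =O[polarInfty] fun z => z.1 ^ s :=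
  (h.comp_tendsto tendsto_circlePt_cobounded).congr' EventuallyEq.rfl
    (norm_rpow_circlePt_eventuallyEq s)

theorem isLittleO_polar {F : Plane → CVec} {s : ℝ}
    (h : F =o[Bornology.cobounded Plane] fun x => ‖x‖ ^ s) :
    (fun z : ℝ × ℝ => F (circlePt z.1 z.2)) =o[polarInfty] fun z => z.1 ^ s :=
  (h.comp_tendsto tendsto_circlePt_cobounded).congr' EventuallyEq.rfl
    (norm_rpow_circlePt_eventuallyEq s)

/-- The scalar factor in the definition of the far field pattern with wave number `k`, at
distance `r`. -/
noncomputable def farFieldFactor (om k r : ℝ) : ℂ :=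
  ((k / om : ℝ) : ℂ) * (Complex.exp (Complex.I * (Real.pi / 4 : ℝ)) / ((√(8 * Real.pi * om) : ℝ) : ℂ))
    * (Complex.exp (Complex.I * ((k * r : ℝ) : ℂ)) / ((√r : ℝ) : ℂ))

theorem norm_farFieldFactor {om k : ℝ} (hom : 0 < om) (hk : 0 < k) {z : ℝ × ℝ} (hz : 0 < z.1) :
    ‖farFieldFactor om k z.1‖ = k / om / √(8 * Real.pi * om) * decay z := by
  have hs : decay z = (√z.1)⁻¹ := by
    rw [decay, Real.sqrt_eq_rpow, ← Real.rpow_neg hz.le]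
  rw [farFieldFactor, norm_mul, norm_mul, norm_div, norm_div, Complex.norm_exp_I_mul_ofReal,
    Complex.norm_exp_I_mul_ofReal, Complex.norm_real, Complex.norm_real, Complex.norm_real,
    Real.norm_of_nonneg (by positivity), Real.norm_of_nonneg (by positivity),
    Real.norm_of_nonneg (by positivity), hs]
  ring

/-- A potential `φ` with `c grad φ` radiating and asymptotically radial, with radial far field
`f`: it is a radiating solution in the sense of `IsRadiatingHelmholtz`, and the energy density of
its gradient converges. -/
theorem isRadiatingHelmholtz_of_farField {om k r₀ : ℝ} (hom : 0 < om) (hk : 0 < k) {D : Set Plane}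
    (hD : IsOpen D) (hr₀ : ∀ r θ, r₀ ≤ r → circlePt r θ ∈ D) {φ : Plane → ℂ}
    (hφ : ContDiffOn ℝ (⊤ : ℕ∞) φ D) (hh : ∀ x ∈ D, lap φ x + (k : ℂ) ^ 2 * φ x = 0)
    {c : ℂ} (hc : c ≠ 0) {f : Plane → ℂ}
    (h1 : (fun z : ℝ × ℝ => c * radD φ z - farFieldFactor om k z.1 * f (circlePt 1 z.2))
      =O[polarInfty] fun z => z.1 ^ (-(3 / 2) : ℝ))
    (h2 : (fun z => c * tanD φ z) =O[polarInfty] fun z => z.1 ^ (-(3 / 2) : ℝ))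
    (h3 : (fun z => c * (radRadD φ z - Complex.I * k * radD φ z)) =o[polarInfty] decay)
    (h4 : (fun z => c * (radTanD φ z - Complex.I * k * tanD φ z)) =o[polarInfty] decay) :
    IsRadiatingHelmholtz D k φ ∧ Continuous (fun θ => ‖f (circlePt 1 θ)‖) ∧
      (fun z : ℝ × ℝ => z.1 * ‖c * radD φ z‖ ^ 2
        - (k / om / √(8 * Real.pi * om)) ^ 2 * ‖f (circlePt 1 z.2)‖ ^ 2)
        =o[polarInfty] fun _ => (1 : ℝ) := by
  obtain ⟨e1, e2, e3⟩ := far_field_modulus (g := fun z => c * radD φ z)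
    (κ := fun z => farFieldFactor om k z.1) (f := fun θ => f (circlePt 1 θ))
    (K := k / om / √(8 * Real.pi * om)) (by have := Real.pi_pos; positivity)
    (periodic_comp_circlePt f 1)
    (by
      filter_upwards [eventually_ge_atTop r₀] with r hr
      exact (continuous_radD hD hφ fun θ => hr₀ r θ hr).const_mul c)
    (by
      filter_upwards [eventually_fst_polarInfty (eventually_gt_atTop 0)] with z hz
      exact norm_farFieldFactor hom hk hz) h1
  exact ⟨⟨hφ, hh, (isBigO_const_mul_left_iff hc).1 e2, (isBigO_const_mul_left_iff hc).1 h2,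
    (isLittleO_const_mul_left_iff hc).1 h3, (isLittleO_const_mul_left_iff hc).1 h4⟩, e1, e3⟩

section Parts

variable {om lam mu k r₀ : ℝ} {D : Set Plane} {u : Plane → CVec}

theorem radialDeriv_circlePt {F : Plane → CVec} {r θ : ℝ} (hr : 0 < r)
    (hF : ∀ i, DifferentiableAt ℝ (fun y => F y i) (circlePt r θ)) (i : Fin 2) :
    radialDeriv F (circlePt r θ) i = radD (fun y => F y i) (r, θ) := by
  rw [radialDeriv, unitVec_circlePt hr, fderiv_apply_apply (differentiableAt_of_apply hF),
    fderiv_apply_eq_pd]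
  simp [radD]

theorem radD_const_mul {φ : Plane → ℂ} {c : ℂ} {z : ℝ × ℝ}
    (hφ : DifferentiableAt ℝ φ (circlePt z.1 z.2)) :
    radD (fun y => c * φ y) z = c * radD φ z := by
  simp only [radD, pd_const_mul _ c hφ]
  ring

theorem pPart_zero (u : Plane → CVec) (x : Plane) :
    pPart om lam mu u x 0 = -(1 / ((kp om lam mu : ℝ) : ℂ) ^ 2) * pd 0 (divg u) x := rfl

theorem pPart_one (u : Plane → CVec) (x : Plane) :
    pPart om lam mu u x 1 = -(1 / ((kp om lam mu : ℝ) : ℂ) ^ 2) * pd 1 (divg u) x := rfl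

theorem sPart_zero (u : Plane → CVec) (x : Plane) :
    sPart om mu u x 0 = 1 / ((ks om mu : ℝ) : ℂ) ^ 2 * pd 1 (divPerp u) x := by
  simp [sPart, gradPerp]

theorem sPart_one (u : Plane → CVec) (x : Plane) :
    sPart om mu u x 1 = -(1 / ((ks om mu : ℝ) : ℂ) ^ 2) * pd 0 (divPerp u) x := rfl

theorem radialDeriv_pPart (hD : IsOpen D) (hu : ContDiffOn ℝ (⊤ : ℕ∞) u D) {r θ : ℝ} (hr : 0 < r)
    (hx : circlePt r θ ∈ D) :
    radialDeriv (pPart om lam mu u) (circlePt r θ) 0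
        = -(1 / ((kp om lam mu : ℝ) : ℂ) ^ 2) * radD (pd 0 (divg u)) (r, θ) ∧
    radialDeriv (pPart om lam mu u) (circlePt r θ) 1
        = -(1 / ((kp om lam mu : ℝ) : ℂ) ^ 2) * radD (pd 1 (divg u)) (r, θ) := by
  have hd : ∀ i, DifferentiableAt ℝ (pd i (divg u)) (circlePt r θ) := fun i =>
    differentiableAt_of_contDiffOn hD (contDiffOn_pd hD (contDiffOn_divg hD hu) i) hx
  have hF : ∀ i, DifferentiableAt ℝ (fun y => pPart om lam mu u y i) (circlePt r θ) := by
    intro i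
    fin_cases i
    · exact (hd 0).const_mul _
    · exact (hd 1).const_mul _
  rw [radialDeriv_circlePt hr hF, radialDeriv_circlePt hr hF]
  simp only [pPart_zero, pPart_one]
  exact ⟨radD_const_mul (hd 0), radD_const_mul (hd 1)⟩

theorem radialDeriv_sPart (hD : IsOpen D) (hu : ContDiffOn ℝ (⊤ : ℕ∞) u D) {r θ : ℝ} (hr : 0 < r)
    (hx : circlePt r θ ∈ D) :
    radialDeriv (sPart om mu u) (circlePt r θ) 0
        = 1 / ((ks om mu : ℝ) : ℂ) ^ 2 * radD (pd 1 (divPerp u)) (r, θ) ∧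
    radialDeriv (sPart om mu u) (circlePt r θ) 1
        = -(1 / ((ks om mu : ℝ) : ℂ) ^ 2) * radD (pd 0 (divPerp u)) (r, θ) := by
  have hd : ∀ i, DifferentiableAt ℝ (pd i (divPerp u)) (circlePt r θ) := fun i =>
    differentiableAt_of_contDiffOn hD (contDiffOn_pd hD (contDiffOn_divPerp hD hu) i) hx
  have hF : ∀ i, DifferentiableAt ℝ (fun y => sPart om mu u y i) (circlePt r θ) := by
    intro i
    fin_cases i
    · simp only [Fin.zero_eta, sPart_zero]
      exact (hd 1).const_mul _
    · exact (hd 0).const_mul _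
  rw [radialDeriv_circlePt hr hF, radialDeriv_circlePt hr hF]
  simp only [sPart_zero, sPart_one]
  exact ⟨radD_const_mul (hd 1), radD_const_mul (hd 0)⟩

theorem eventually_mem (hr₀ : ∀ r θ, r₀ ≤ r → circlePt r θ ∈ D) :
    ∀ᶠ z : ℝ × ℝ in polarInfty, 0 < z.1 ∧ circlePt z.1 z.2 ∈ D := by
  filter_upwards [eventually_fst_polarInfty (eventually_gt_atTop 0),
    eventually_fst_polarInfty (eventually_ge_atTop r₀)] with z h1 h2 using ⟨h1, hr₀ _ _ h2⟩

theorem IsNavier.radiating_divg (h : IsNavier om lam mu D u) (hom : 0 < om) (hmu : 0 < mu)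
    (hlam : 0 < 2 * mu + lam) (hD : IsOpen D) (hr₀ : ∀ r θ, r₀ ≤ r → circlePt r θ ∈ D)
    (hrad : Radiating om lam mu u) {fp fs : Plane → ℂ} (hff : IsFarField om lam mu u fp fs) :
    IsRadiatingHelmholtz D (kp om lam mu) (divg u) ∧ Continuous (fun θ => ‖fp (circlePt 1 θ)‖) ∧
      (fun z : ℝ × ℝ => z.1 * ‖-(1 / ((kp om lam mu : ℝ) : ℂ) ^ 2) * radD (divg u) z‖ ^ 2
        - (kp om lam mu / om / √(8 * Real.pi * om)) ^ 2 * ‖fp (circlePt 1 z.2)‖ ^ 2)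
        =o[polarInfty] fun _ => (1 : ℝ) := by
  have hk := kp_pos hom hlam
  have hkc : ((kp om lam mu : ℝ) : ℂ) ≠ 0 := by exact_mod_cast hk.ne'
  refine isRadiatingHelmholtz_of_farField hom hk hD hr₀ (contDiffOn_divg hD h.smooth)
    (fun x hx => h.helmholtz_divg hom hmu hlam hD hx) (by simpa using hkc) ?_ ?_ ?_ ?_
  · refine ((radComp_isBigO _).trans (isBigO_polar hff.1)).congr' ?_ EventuallyEq.rfl
    filter_upwards [eventually_mem hr₀] with z hz
    set κ := farFieldFactor om (kp om lam mu) z.1 with hκ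
    rw [farFieldFactor] at hκ
    simp only [radComp, norm_circlePt hz.1.le, unitVec_circlePt hz.1, PiLp.sub_apply,
      PiLp.smul_apply, smul_eq_mul, pPart_zero, pPart_one, radD, toC,
      Matrix.cons_val_zero, Matrix.cons_val_one, Matrix.cons_val_fin_one, circlePt_zero,
      circlePt_one, one_mul]
    rw [← hκ]
    linear_combination (-(κ * fp (circlePt 1 z.2)))
      * cos_sq_add_sin_sq_complex z.2
  · refine ((tanComp_isBigO _).trans (isBigO_polar hff.1)).congr' ?_ EventuallyEq.rfl
    filter_upwards [eventually_mem hr₀] with z hz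
    simp only [tanComp, norm_circlePt hz.1.le, unitVec_circlePt hz.1, PiLp.sub_apply,
      PiLp.smul_apply, smul_eq_mul, pPart_zero, pPart_one, tanD, toC,
      Matrix.cons_val_zero, Matrix.cons_val_one, Matrix.cons_val_fin_one, circlePt_zero,
      circlePt_one, one_mul]
    ring
  · refine ((radComp_isBigO _).trans_isLittleO (isLittleO_polar hrad.1)).congr' ?_ EventuallyEq.rfl
    filter_upwards [eventually_mem hr₀] with z hz
    obtain ⟨e0, e1⟩ := radialDeriv_pPart (om := om) (lam := lam) (mu := mu) hD h.smooth hz.1 hz.2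
    simp only [radComp, PiLp.sub_apply, PiLp.smul_apply, smul_eq_mul, e0, e1, pPart_zero,
      pPart_one, radRadD]
    simp only [radD]
    ring
  · refine ((tanComp_isBigO _).trans_isLittleO (isLittleO_polar hrad.1)).congr' ?_ EventuallyEq.rfl
    filter_upwards [eventually_mem hr₀] with z hz
    obtain ⟨e0, e1⟩ := radialDeriv_pPart (om := om) (lam := lam) (mu := mu) hD h.smooth hz.1 hz.2
    simp only [tanComp, PiLp.sub_apply, PiLp.smul_apply, smul_eq_mul, e0, e1, pPart_zero,
      pPart_one, radTanD]
    simp only [tanD, radD]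
    ring

theorem IsNavier.radiating_divPerp (h : IsNavier om lam mu D u) (hom : 0 < om) (hmu : 0 < mu)
    (hlam : 0 < 2 * mu + lam) (hD : IsOpen D) (hr₀ : ∀ r θ, r₀ ≤ r → circlePt r θ ∈ D)
    (hrad : Radiating om lam mu u) {fp fs : Plane → ℂ} (hff : IsFarField om lam mu u fp fs) :
    IsRadiatingHelmholtz D (ks om mu) (divPerp u) ∧ Continuous (fun θ => ‖fs (circlePt 1 θ)‖) ∧
      (fun z : ℝ × ℝ => z.1 * ‖-(1 / ((ks om mu : ℝ) : ℂ) ^ 2) * radD (divPerp u) z‖ ^ 2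
        - (ks om mu / om / √(8 * Real.pi * om)) ^ 2 * ‖fs (circlePt 1 z.2)‖ ^ 2)
        =o[polarInfty] fun _ => (1 : ℝ) := by
  have hk := ks_pos hom hmu
  have hkc : ((ks om mu : ℝ) : ℂ) ≠ 0 := by exact_mod_cast hk.ne'
  refine isRadiatingHelmholtz_of_farField hom hk hD hr₀ (contDiffOn_divPerp hD h.smooth)
    (fun x hx => h.helmholtz_divPerp hom hmu hlam hD hx) (by simpa using hkc) ?_ ?_ ?_ ?_
  · refine ((tanComp_isBigO _).trans (isBigO_polar hff.2)).congr' ?_ EventuallyEq.rfl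
    filter_upwards [eventually_mem hr₀] with z hz
    set κ := farFieldFactor om (ks om mu) z.1 with hκ
    rw [farFieldFactor] at hκ
    simp only [tanComp, norm_circlePt hz.1.le, unitVec_circlePt hz.1, PiLp.sub_apply,
      PiLp.smul_apply, smul_eq_mul, sPart_zero, sPart_one, radD, toC, perp,
      Matrix.cons_val_zero, Matrix.cons_val_one, Matrix.cons_val_fin_one, circlePt_zero,
      circlePt_one, one_mul, Complex.ofReal_neg]
    rw [← hκ]
    linear_combination (-(κ * fs (circlePt 1 z.2)))
      * cos_sq_add_sin_sq_complex z.2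
  · refine ((radComp_isBigO _).trans (isBigO_polar hff.2)).neg_left.congr' ?_ EventuallyEq.rfl
    filter_upwards [eventually_mem hr₀] with z hz
    simp only [radComp, norm_circlePt hz.1.le, unitVec_circlePt hz.1, PiLp.sub_apply,
      PiLp.smul_apply, smul_eq_mul, sPart_zero, sPart_one, tanD, toC, perp,
      Matrix.cons_val_zero, Matrix.cons_val_one, Matrix.cons_val_fin_one, circlePt_zero,
      circlePt_one, one_mul, Complex.ofReal_neg]
    ring
  · refine ((tanComp_isBigO _).trans_isLittleO (isLittleO_polar hrad.2)).congr' ?_ EventuallyEq.rfl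
    filter_upwards [eventually_mem hr₀] with z hz
    obtain ⟨e0, e1⟩ := radialDeriv_sPart (om := om) (mu := mu) hD h.smooth hz.1 hz.2
    simp only [tanComp, PiLp.sub_apply, PiLp.smul_apply, smul_eq_mul, e0, e1, sPart_zero,
      sPart_one, radRadD]
    simp only [radD]
    ring
  · refine ((radComp_isBigO _).trans_isLittleO
      (isLittleO_polar hrad.2)).neg_left.congr' ?_ EventuallyEq.rfl
    filter_upwards [eventually_mem hr₀] with z hz
    obtain ⟨e0, e1⟩ := radialDeriv_sPart (om := om) (mu := mu) hD h.smooth hz.1 hz.2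
    simp only [radComp, PiLp.sub_apply, PiLp.smul_apply, smul_eq_mul, e0, e1, sPart_zero,
      sPart_one, radTanD]
    simp only [tanD, radD]
    ring

end Parts

/-! ### The energy flux at infinity -/

namespace IsNavier

variable {om lam mu r₀ : ℝ} {D : Set Plane} {u : Plane → CVec}

/-- The energy flux density in terms of the polar derivatives of the potentials `div u` and
`div^⊥ u`. -/
theorem cdot_traction_polar (h : IsNavier om lam mu D u) (hom : 0 < om) (hmu : 0 < mu)
    (hlam : 0 < 2 * mu + lam) (hD : IsOpen D) {a b : ℂ}
    (ha : a = 1 / ((kp om lam mu : ℝ) : ℂ) ^ 2) (hb : b = 1 / ((ks om mu : ℝ) : ℂ) ^ 2)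
    {z : ℝ × ℝ} (hr : 0 < z.1) (hx : circlePt z.1 z.2 ∈ D) :
    cdot (u (circlePt z.1 z.2))
        (conjVec (traction lam mu (unitVec (circlePt z.1 z.2)) u (circlePt z.1 z.2)))
      = 2 * mu * ((-a * radD (divg u) z + b * tanD (divPerp u) z)
            * (starRingEnd ℂ) (-a * radRadD (divg u) z + b * radTanD (divPerp u) z)
          + (-a * tanD (divg u) z - b * radD (divPerp u) z)
            * (starRingEnd ℂ) (-a * radTanD (divg u) z - b * radRadD (divPerp u) z))
        + lam * ((-a * radD (divg u) z + b * tanD (divPerp u) z)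
            * (starRingEnd ℂ) (divg u (circlePt z.1 z.2)))
        - mu * ((-a * tanD (divg u) z - b * radD (divPerp u) z)
            * (starRingEnd ℂ) (divPerp u (circlePt z.1 z.2))) := by
  have hu := differentiableAt_of_contDiffOn hD h.smooth hx
  have hsc := cos_sq_add_sin_sq_complex z.2
  rw [unitVec_circlePt hr]
  set φ := divg u with hφ
  set ψ := divPerp u with hψ
  set x := circlePt z.1 z.2 with hxdef
  -- The Cartesian components of the vectors with the polar components appearing on the right.
  have t0 : traction lam mu (circlePt 1 z.2) u x 0
      = 2 * mu * (-a * radD (pd 0 φ) z + b * radD (pd 1 ψ) z) + lam * φ x * Real.cos z.2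
        + mu * ψ x * Real.sin z.2 := by
    rw [traction_apply hu, h.pd_apply_zero hom hmu hlam hD hx, h.pd_apply_zero hom hmu hlam hD hx,
      ← ha, ← hb]
    simp only [radD, perp, ← hxdef, ← hφ, ← hψ, circlePt_zero, circlePt_one, one_mul,
      Matrix.cons_val_zero, Complex.ofReal_neg]
    ring
  have t1 : traction lam mu (circlePt 1 z.2) u x 1
      = 2 * mu * (-a * radD (pd 1 φ) z - b * radD (pd 0 ψ) z) + lam * φ x * Real.sin z.2
        - mu * ψ x * Real.cos z.2 := by
    rw [traction_apply hu, h.pd_apply_one hom hmu hlam hD hx, h.pd_apply_one hom hmu hlam hD hx,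
      ← ha, ← hb]
    simp only [radD, perp, ← hxdef, ← hφ, ← hψ, circlePt_zero, circlePt_one, one_mul,
      Matrix.cons_val_one, Matrix.cons_val_fin_one]
    ring
  simp only [cdot, conjVec, Matrix.cons_val_zero, Matrix.cons_val_one, Matrix.cons_val_fin_one,
    t0, t1, h.apply_zero hom hmu hlam hD hx, h.apply_one hom hmu hlam hD hx, ← ha, ← hb, ← hφ, ← hψ]
  simp only [radRadD, radTanD]
  generalize radD (pd 0 φ) z = φ₀
  generalize radD (pd 1 φ) z = φ₁
  generalize radD (pd 0 ψ) z = ψ₀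
  generalize radD (pd 1 ψ) z = ψ₁
  simp only [radD, tanD, ← hxdef, map_add, map_sub, map_mul, map_neg, Complex.conj_ofReal, map_ofNat]
  linear_combination (-2 * mu * ((-a * pd 0 φ x + b * pd 1 ψ x)
      * (-(starRingEnd ℂ) a * (starRingEnd ℂ) φ₀ + (starRingEnd ℂ) b * (starRingEnd ℂ) ψ₁)
    + (-a * pd 1 φ x - b * pd 0 ψ x)
      * (-(starRingEnd ℂ) a * (starRingEnd ℂ) φ₁ - (starRingEnd ℂ) b * (starRingEnd ℂ) ψ₀))) * hsc

/-- The energy flux through large circles is computed by replacing, up to terms which vanish in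
the limit, the radial derivatives by multiplication with `ik`, and the potentials `div u` and
`div^⊥ u` by `(i/k)` times their conjugated radial derivatives under the integral. -/
theorem tendsto_arcIntegral (h : IsNavier om lam mu D u) (hom : 0 < om) (hmu : 0 < mu)
    (hlam : 0 < 2 * mu + lam) (hD : IsOpen D) (hr₀ : ∀ r θ, r₀ ≤ r → circlePt r θ ∈ D)
    (hrad : Radiating om lam mu u) {fp fs : Plane → ℂ} (hff : IsFarField om lam mu u fp fs) :
    Tendsto (fun r => arcIntegral r fun x =>
        cdot (u x) (conjVec (traction lam mu (unitVec x) u x))) atTop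
      (𝓝 (-Complex.I * ((∫ θ in (0 : ℝ)..(2 * Real.pi),
        (kp om lam mu * (2 * mu + lam) * (kp om lam mu / om / √(8 * Real.pi * om)) ^ 2
            * ‖fp (circlePt 1 θ)‖ ^ 2
          + ks om mu * mu * (ks om mu / om / √(8 * Real.pi * om)) ^ 2
            * ‖fs (circlePt 1 θ)‖ ^ 2) : ℝ) : ℂ))) := by
  obtain ⟨hP, hPc, hPm⟩ := h.radiating_divg hom hmu hlam hD hr₀ hrad hff
  obtain ⟨hS, hSc, hSm⟩ := h.radiating_divPerp hom hmu hlam hD hr₀ hrad hff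
  have hk := kp_pos hom hlam
  have hl := ks_pos hom hmu
  set k := kp om lam mu with hkdef
  set l := ks om mu with hldef
  set K := k / om / √(8 * Real.pi * om)
  set L := l / om / √(8 * Real.pi * om)
  have hkc : (k : ℂ) ≠ 0 := by exact_mod_cast hk.ne'
  have hlc : (l : ℂ) ≠ 0 := by exact_mod_cast hl.ne'
  set φ := divg u with hφ
  set ψ := divPerp u with hψ
  obtain ⟨a, ha⟩ : ∃ a : ℂ, a = 1 / (k : ℂ) ^ 2 := ⟨_, rfl⟩
  obtain ⟨b, hb⟩ : ∃ b : ℂ, b = 1 / (l : ℂ) ^ 2 := ⟨_, rfl⟩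
  rw [← ha] at hPm
  rw [← hb] at hSm
  have hak : a * (k : ℂ) ^ 2 = 1 := by rw [ha]; field_simp
  have hbl : b * (l : ℂ) ^ 2 = 1 := by rw [hb]; field_simp
  have hac : (starRingEnd ℂ) a = a := by simp [ha]
  have hbc : (starRingEnd ℂ) b = b := by simp [hb]
  set g : ℝ → ℝ := fun θ => k * (2 * mu + lam) * K ^ 2 * ‖fp (circlePt 1 θ)‖ ^ 2
    + l * mu * L ^ 2 * ‖fs (circlePt 1 θ)‖ ^ 2 with hg
  have hgc : Continuous g := by
    simp only [hg]
    fun_prop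
  set N : ℝ × ℝ → ℂ := fun z => cdot (u (circlePt z.1 z.2))
    (conjVec (traction lam mu (unitVec (circlePt z.1 z.2)) u (circlePt z.1 z.2))) with hN
  set J : ℝ → (Plane → ℂ) → ℝ × ℝ → ℂ := fun κ χ z => (z.1 : ℂ) *
    ((κ : ℂ) ^ 2 * (radD χ z * (starRingEnd ℂ) (χ (circlePt z.1 z.2)))
      - Complex.I * κ * (radD χ z * (starRingEnd ℂ) (radD χ z))) with hJ
  set e : ℝ × ℝ → ℂ := fun z => (z.1 : ℂ) * N z + lam * a ^ 2 * J k φ z - mu * b ^ 2 * J l ψ z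
    + Complex.I * g z.2 with he
  have ofReal_o : ∀ {f : ℝ × ℝ → ℝ}, f =o[polarInfty] (fun _ => (1 : ℝ)) →
      (fun z => (f z : ℂ)) =o[polarInfty] fun _ => (1 : ℝ) := fun {f} hf =>
    (IsBigO.of_bound 1 (Eventually.of_forall fun z => by simp) :
      (fun z => (f z : ℂ)) =O[polarInfty] f).trans_isLittleO hf
  have he0 : e =o[polarInfty] fun _ => (1 : ℝ) := by
    have AP := hP.radD_isBigO
    have BP := hP.tanD_isLittleO
    have RP := isBigO_conj hP.radRadD_isBigO
    have dP := isLittleO_conj hP.radRadD_isLittleO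
    have TP := isLittleO_conj hP.radTanD_isLittleO'
    have FP := isBigO_conj (hP.isBigO hD hk hr₀)
    have AS := hS.radD_isBigO
    have BS := hS.tanD_isLittleO
    have RS := isBigO_conj hS.radRadD_isBigO
    have dS := isLittleO_conj hS.radRadD_isLittleO
    have TS := isLittleO_conj hS.radTanD_isLittleO'
    have FS := isBigO_conj (hS.isBigO hD hl hr₀)
    have m1 := (isBigO_decay_mul_isLittleO AP dP).const_mul_left (2 * mu * a ^ 2)
    have m2 := (isBigO_decay_mul_isLittleO AP TS).const_mul_left (-2 * mu * a * b)
    have m3 := (isBigO_decay_mul_isLittleO RP BS).const_mul_left (-2 * mu * a * b)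
    have m4 := (isBigO_decay_mul_isLittleO BS.isBigO TS).const_mul_left (2 * mu * b ^ 2)
    have m5 := (isBigO_decay_mul_isLittleO BP.isBigO TP).const_mul_left (2 * mu * a ^ 2)
    have m6 := (isBigO_decay_mul_isLittleO RS BP).const_mul_left (2 * mu * a * b)
    have m7 := (isBigO_decay_mul_isLittleO AS TP).const_mul_left (2 * mu * a * b)
    have m8 := (isBigO_decay_mul_isLittleO AS dS).const_mul_left (2 * mu * b ^ 2)
    have m9 := (isBigO_decay_mul_isLittleO FP BS).const_mul_left (lam * b)
    have m10 := (isBigO_decay_mul_isLittleO FS BP).const_mul_left (mu * a)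
    have m11 := (ofReal_o hPm).const_mul_left (-Complex.I * k * (2 * mu + lam))
    have m12 := (ofReal_o hSm).const_mul_left (-Complex.I * l * mu)
    refine ((((((((((((m1.add m2).add m3).add m4).add m5).add m6).add m7).add m8).add m9).add
      m10).add m11).add m12)).congr' ?_ EventuallyEq.rfl
    filter_upwards [eventually_mem hr₀] with z hz
    simp only [he, hN, hJ, hg, h.cdot_traction_polar hom hmu hlam hD ha hb hz.1 hz.2, ← hφ, ← hψ]
    push_cast
    rw [← Complex.mul_conj' (-a * radD φ z), ← Complex.mul_conj' (-b * radD ψ z)]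
    simp only [map_add, map_sub, map_mul, map_neg, Complex.conj_ofReal, Complex.conj_I, hac, hbc]
    linear_combination (-(lam * a * z.1 * radD φ z * (starRingEnd ℂ) (φ (circlePt z.1 z.2)))) * hak
      + (mu * b * z.1 * radD ψ z * (starRingEnd ℂ) (ψ (circlePt z.1 z.2))) * hbl
  have limP : Tendsto (fun r => ∫ θ in (0 : ℝ)..(2 * Real.pi), J k φ (r, θ)) atTop (𝓝 0) :=
    hP.tendsto_integral hD hr₀
  have limS : Tendsto (fun r => ∫ θ in (0 : ℝ)..(2 * Real.pi), J l ψ (r, θ)) atTop (𝓝 0) :=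
    hS.tendsto_integral hD hr₀
  have lim := ((tendsto_integral_of_isLittleO_one he0).sub (limP.const_mul (lam * a ^ 2))).add
    (limS.const_mul (mu * b ^ 2))
  have lim' := lim.add_const (-Complex.I * ((∫ θ in (0 : ℝ)..(2 * Real.pi), g θ : ℝ) : ℂ))
  simp only [mul_zero, sub_zero, add_zero, zero_add] at lim'
  refine lim'.congr' ?_
  filter_upwards [eventually_gt_atTop 0, eventually_ge_atTop r₀] with r hr hr'
  have hcirc : ∀ θ, circlePt r θ ∈ D := fun θ => hr₀ r θ hr'
  have cN : Continuous fun θ => N (r, θ) := h.continuous_cdot_traction hD hr hcirc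
  have cJ : ∀ (κ : ℝ) {χ : Plane → ℂ}, ContDiffOn ℝ (⊤ : ℕ∞) χ D →
      Continuous fun θ => J κ χ (r, θ) := by
    intro κ χ hχ
    have c0 := continuous_radD hD hχ hcirc
    have c1 := Complex.continuous_conj.comp c0
    have c2 := Complex.continuous_conj.comp (continuous_comp_circlePt hD hχ hcirc)
    simp only [Function.comp_def] at c1 c2
    simp only [hJ]
    fun_prop
  have cP := cJ k hP.smooth
  have cS := cJ l hS.smooth
  have cg : Continuous fun θ => (g θ : ℂ) := Complex.continuous_ofReal.comp hgc
  have cP' : Continuous fun θ => lam * a ^ 2 * J k φ (r, θ) := continuous_const.mul cP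
  have cS' : Continuous fun θ => mu * b ^ 2 * J l ψ (r, θ) := continuous_const.mul cS
  have cg' : Continuous fun θ => -Complex.I * g θ := continuous_const.mul cg
  have ce' : Continuous fun θ => (r : ℂ) * N (r, θ) + lam * a ^ 2 * J k φ (r, θ)
      - mu * b ^ 2 * J l ψ (r, θ) + Complex.I * g θ :=
    (((continuous_const.mul cN).add cP').sub cS').add (continuous_const.mul cg)
  have ce : Continuous fun θ => e (r, θ) := ce'
  have hI : ∀ {f : ℝ → ℂ}, Continuous f → IntervalIntegrable f volume 0 (2 * Real.pi) :=
    fun hf => hf.intervalIntegrable _ _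
  have c1 : Continuous fun θ => e (r, θ) - lam * a ^ 2 * J k φ (r, θ) :=
    ce.sub cP'
  have c2 : Continuous fun θ => e (r, θ) - lam * a ^ 2 * J k φ (r, θ)
      + mu * b ^ 2 * J l ψ (r, θ) := c1.add cS'
  rw [← intervalIntegral.integral_ofReal, ← intervalIntegral.integral_const_mul,
    ← intervalIntegral.integral_const_mul, ← intervalIntegral.integral_const_mul,
    ← intervalIntegral.integral_sub (hI ce) (hI cP'),
    ← intervalIntegral.integral_add (hI c1) (hI cS'),
    ← intervalIntegral.integral_add (hI c2) (hI cg'), arcIntegral]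
  refine intervalIntegral.integral_congr fun θ _ => ?_
  simp only [he, hN, Complex.real_smul]
  ring

/-- The energy flux through a circle such that the equation holds on it and outside of it. -/
theorem energyFlux_eq_farField (h : IsNavier om lam mu D u) (hom : 0 < om) (hmu : 0 < mu)
    (hlam : 0 < 2 * mu + lam) (hD : IsOpen D) {r : ℝ} (hr : 0 < r) (hDr : ∀ x, r ≤ ‖x‖ → x ∈ D)
    (hrad : Radiating om lam mu u) {fp fs : Plane → ℂ} (hff : IsFarField om lam mu u fp fs) :
    energyFlux om lam mu u r = 1 / (2 * Real.pi) * arcIntegral 1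
      (fun x => kp om lam mu * ‖fp x‖ ^ 2 + ks om mu * ‖fs x‖ ^ 2) := by
  have hr₀ : ∀ ρ θ, r ≤ ρ → circlePt ρ θ ∈ D := fun ρ θ hρ =>
    hDr _ (by rwa [norm_circlePt (hr.le.trans hρ)])
  have hlim := h.tendsto_arcIntegral hom hmu hlam hD hr₀ hrad hff
  have hlim' := ((Complex.continuous_im.tendsto _).comp hlim).const_mul (-4 * om)
  have hconst : Tendsto (fun _ : ℝ => energyFlux om lam mu u r) atTop
      (𝓝 (energyFlux om lam mu u r)) := tendsto_const_nhds
  have hev : (fun R => -4 * om * (Complex.im ∘ fun r => arcIntegral r fun x =>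
      cdot (u x) (conjVec (traction lam mu (unitVec x) u x))) R)
      =ᶠ[atTop] fun _ => energyFlux om lam mu u r := by
    filter_upwards [eventually_ge_atTop r] with R hR
    exact (h.energyFlux_eq hD hr hR hDr).symm
  rw [tendsto_nhds_unique hconst (hlim'.congr' hev)]
  simp only [neg_mul, Complex.neg_im, Complex.I_mul_im, Complex.ofReal_re]
  rw [mul_neg, neg_neg, arcIntegral, ← intervalIntegral.integral_const_mul,
    ← intervalIntegral.integral_const_mul]
  refine intervalIntegral.integral_congr fun θ _ => ?_
  have hpi := Real.pi_pos
  have h1 : √(8 * Real.pi * om) ^ 2 = 8 * Real.pi * om := Real.sq_sqrt (by positivity)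
  have h2 : kp om lam mu ^ 2 * (2 * mu + lam) = om ^ 2 := by
    rw [← kp_sq (om := om) hlam]; ring
  have h3 := ks_sq (om := om) hmu
  simp only [div_pow, h1, one_smul]
  field_simp
  linear_combination (8 * kp om lam mu * ‖fp (circlePt 1 θ)‖ ^ 2) * h2
    + (8 * ks om mu * ‖fs (circlePt 1 θ)‖ ^ 2) * h3

end IsNavier

end Elastic

theorem theorem2p1 (om lam mu : ℝ) (hom : 0 < om) (hmu : 0 < mu) (hlam : 0 < 2 * mu + lam) :
    (∀ (Ω : Set Plane) (m : WaveType) (d : Plane) (usc : Plane → CVec) (fp fs : Plane → ℂ) (r : ℝ),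
      IsScatterer Ω → ‖d‖ = 1 →
      IsScatteredField om lam mu Ω m d usc →
      IsFarField om lam mu usc fp fs →
      closure Ω ⊆ Metric.ball 0 r →
      energyFlux om lam mu usc r
        = 1 / (2 * Real.pi) * arcIntegral 1
            (fun x => kp om lam mu * ‖fp x‖ ^ 2 + ks om mu * ‖fs x‖ ^ 2)) ∧
    (∀ (Ω Ω' : Set Plane) (m m' : WaveType) (d d' : Plane) (usc usc' : Plane → CVec)
        (fp fs fp' fs' : Plane → ℂ) (r r' : ℝ),
      IsScatterer Ω → ‖d‖ = 1 →
      IsScatteredField om lam mu Ω m d usc →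
      IsFarField om lam mu usc fp fs →
      closure Ω ⊆ Metric.ball 0 r →
      IsScatterer Ω' → ‖d'‖ = 1 →
      IsScatteredField om lam mu Ω' m' d' usc' →
      IsFarField om lam mu usc' fp' fs' →
      closure Ω' ⊆ Metric.ball 0 r' →
      (∀ x : Plane, ‖x‖ = 1 → ‖fp x‖ = ‖fp' x‖ ∧ ‖fs x‖ = ‖fs' x‖) →
      energyFlux om lam mu usc r = energyFlux om lam mu usc' r') := by
  have flux : ∀ (Ω : Set Plane) (m : WaveType) (d : Plane) (usc : Plane → CVec)
      (fp fs : Plane → ℂ) (r : ℝ), IsScatterer Ω → ‖d‖ = 1 →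
      IsScatteredField om lam mu Ω m d usc → IsFarField om lam mu usc fp fs →
      closure Ω ⊆ Metric.ball 0 r →
      energyFlux om lam mu usc r = 1 / (2 * Real.pi) * arcIntegral 1
        (fun x => kp om lam mu * ‖fp x‖ ^ 2 + ks om mu * ‖fs x‖ ^ 2) := by
    intro Ω m d usc fp fs r hΩ _ hu hff hball
    obtain ⟨x, hx⟩ := hΩ.nonempty
    have hr : 0 < r := Metric.pos_of_mem_ball (hball (subset_closure hx))
    have hnav : IsNavier om lam mu (closure Ω)ᶜ usc := ⟨hu.smooth, hu.navier⟩
    refine hnav.energyFlux_eq_farField hom hmu hlam isClosed_closure.isOpen_compl hr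
      (fun y hy hmem => ?_) hu.radiating hff
    exact (mem_ball_zero_iff.1 (hball hmem)).not_ge hy
  refine ⟨flux, ?_⟩
  intro Ω Ω' m m' d d' usc usc' fp fs fp' fs' r r' hΩ hd hu hff hr hΩ' hd' hu' hff' hr' heq
  rw [flux Ω m d usc fp fs r hΩ hd hu hff hr, flux Ω' m' d' usc' fp' fs' r' hΩ' hd' hu' hff' hr',
    arcIntegral, arcIntegral]
  congr 1
  refine intervalIntegral.integral_congr fun θ _ => ?_
  obtain ⟨h1, h2⟩ := heq (circlePt 1 θ) (norm_circlePt zero_le_one θ)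
  simp only [h1, h2]
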